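/- **Conventions.** All manifolds are smooth Hausdorff manifolds modelled on real Hausdorff locally convex spaces (the model space may vary from chart to chart), and smoothness is in the sense of Michal–Bastiani: $f$ is $C^0$ if continuous, and $C^{k+1}$ if it is continuous, all directional derivatives $df(x,v)$ exist and $df$ is $C^k$. A subset $S$ of a manifold is a submanifold if around each of its points there is a chart in which $S$ corresponds to a closed linear subspace of the model space. Let $G$ be a Lie group and $M$ a $G$-manifold (a manifold with a smooth left action of $G$). A Lie subgroup $H\subseteq G$ is a subgroup that is a submanifold; it is *principal* if $G/H$ carries a manifold structure for which $G\to G/H$ is a smooth principal $H$-bundle. The action is *proper* if preimages of compact sets under $G\times M\to M\times M$, $(g,m)\mapsto(g\cdot m,m)$, are compact. For conjugacy classes of subgroups, $(K)\le(H)$ means that some representative of $(K)$ is contained in some representative of $(H)$. The orbit type of $m$ is the class $(G_m)$ of its stabilizer, $M_{(H)}=\{m: (G_m)=(H)\}$ and $M_{\ge(H)}=\{m:(H)\le(G_m)\}$. A *slice* at $m\in M$ is a submanifold $S\ni m$ such that (1) $G_m\cdot S\subseteq S$; (2) $(g\cdot S)\cap S\ne\emptyset$ implies $g\in G_m$; (3)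 $G_m$ is a principal Lie subgroup and there is a smooth local section $\chi:U\to G$ of $G\to G/G_m$ on an open neighbourhood $U$ of $[e]$ such that $U\times S\to M$, $([g],s)\mapsto\chi([g])\cdot s$, is a diffeomorphism onto an open neighbourhood of $m$; (4) $\{s\in S: G_s\text{ is conjugate to }G_m\text{ in }G\}$ is a closed submanifold of $S$. The slice is *linear* if, moreover, there are a continuous representation of $G_m$ on a locally convex space $X$ and a $G_m$-equivariant diffeomorphism $\iota$ from a $G_m$-invariant open neighbourhood of $0$ in $X$ onto $S$ with $\iota(0)=m$. A *stratification* of a Hausdorff space $X$ is a partition of $X$ into nonempty locally closed subsets $X_\sigma$, each equipped with a manifold structure inducing the subspace topology, such that whenever $\varsigma\neq\sigma$ and $X_\varsigma\cap\overline{X_\sigma}\neq\emptyset$ (written $X_\varsigma<X_\sigma$), one has $X_\varsigma\subseteq\overline{X_\sigma}\setminus X_\sigma$ and $X_\sigma\cap\overline{X_\varsigma}=\emptyset$. It is *smoothly regular* if, for all $X_\varsigma<X_\sigma$ and $x\in X_\varsigma$, there is an open neighbourhood $U$ of $x$ in $X$ such that for every $y\in U\cap X_\sigma$ there exists an injective continuous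 linear map $T_xX_\varsigma\to T_yX_\sigma$. **Proposition.** Let $G$ be a Lie group and $M$ a $G$-manifold with proper $G$-action. Assume that at every $m\in M$ there is a linear slice $S$ such that the $G_m$-manifold $S$ (with the Lie group $G_m$) admits a linear slice at each of its points. Assume also that the approximation property $M_{\ge(H)}\subseteq\overline{M_{(H)}}$ holds for every orbit type $(H)$ of the action. Then every $M_{(H)}$ is a submanifold of $M$, and with the induced manifold structures the following holds. 1. Let $(K)\le(H)$ be orbit types of the action and $m\in M_{(H)}$. There is an open neighbourhood $V$ of $m$ in $M$ such that for every $v\in V\cap M_{(K)}$ there exists an injective continuous linear map $T_mM_{(H)}\to T_vM_{(K)}$. 2. The partition of $M$ into the sets $M_{(H)}$ is a stratification, and it is smoothly regular. -/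

import Mathlib

open Set Filter Topology

universe uE uG uM

noncomputable section

/-! ## Locally convex spaces and differential calculus -/

/-- A (bundled) real Hausdorff locally convex topological vector space. -/
structure LCSpace.{a} : Type (a + 1) where
  carrier : Type a
  [addCommGroup : AddCommGroup carrier]
  [module : Module ℝ carrier]
  [topologicalSpace : TopologicalSpace carrier]
  [isTopologicalAddGroup : IsTopologicalAddGroup carrier]
  [continuousSMul : ContinuousSMul ℝ carrier]
  [locallyConvexSpace : LocallyConvexSpace ℝ carrier]
  [t2Space : T2Space carrier]

instance : CoeSort LCSpace (Type _) := ⟨LCSpace.carrier⟩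

attribute [instance] LCSpace.addCommGroup LCSpace.module LCSpace.topologicalSpace
  LCSpace.isTopologicalAddGroup LCSpace.continuousSMul LCSpace.locallyConvexSpace LCSpace.t2Space

/-- The product of two locally convex spaces. -/
@[reducible] def LCSpace.prod.{a} (E F : LCSpace.{a}) : LCSpace.{a} := { carrier := E × F }

/-- A linear subspace of a locally convex space, with the subspace topology. -/
@[reducible] def LCSpace.sub.{a} (E : LCSpace.{a}) (F : Submodule ℝ E) : LCSpace.{a} := { carrier := F }

/-- `w` is the directional derivative of `f` at `x` in the direction `v`. -/
def HasDirDeriv {E F : Type*} [AddCommGroup E] [Module ℝ E] [AddCommGroup F] [Module ℝ F]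
    [TopologicalSpace F] (f : E → F) (w : F) (x v : E) : Prop :=
  Tendsto (fun t : ℝ => t⁻¹ • (f (x + t • v) - f x)) (𝓝[≠] 0) (𝓝 w)

/-- `f` is of class `C^n` on the open set `U` in the sense of Michal and Bastiani:
`f` is continuous on `U` and, if `n = k + 1`, all directional derivatives `df (x, v)`, `x ∈ U`,
exist and `df` is of class `C^k` on `U × E`. -/
def IsCk.{a} {F : Type*} [AddCommGroup F] [Module ℝ F] [TopologicalSpace F] :
    ℕ → ∀ {E : Type a} [AddCommGroup E] [Module ℝ E] [TopologicalSpace E],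
      (E → F) → Set E → Prop
  | 0, _, _, _, _, f, U => ContinuousOn f U
  | n + 1, E, _, _, _, f, U => ContinuousOn f U ∧
      ∃ df : E × E → F, (∀ x ∈ U, ∀ v, HasDirDeriv f (df (x, v)) x v) ∧
        IsCk n df (U ×ˢ (univ : Set E))

/-- Smoothness on an open set. -/
def IsSmoothOn {E F : Type*} [AddCommGroup E] [Module ℝ E] [TopologicalSpace E]
    [AddCommGroup F] [Module ℝ F] [TopologicalSpace F] (f : E → F) (U : Set E) : Prop :=
  ∀ n : ℕ, IsCk n f U

/-! ## Manifolds modelled on locally convex spaces -/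

/-- A chart of `M` with values in some locally convex space (which is part of the chart). -/
structure LCChart.{a, b} (M : Type b) [TopologicalSpace M] : Type (max b (a + 1)) where
  model : LCSpace.{a}
  toHomeo : OpenPartialHomeomorph M model

/-- The transition map from `c` to `c'` is smooth. -/
def LCChart.SmoothTransition.{a, b} {M : Type b} [TopologicalSpace M] (c c' : LCChart.{a} M) :
    Prop :=
  IsSmoothOn (c'.toHomeo ∘ c.toHomeo.symm)
    (c.toHomeo.target ∩ c.toHomeo.symm ⁻¹' c'.toHomeo.source)

/-- An atlas on `M`, whose charts may have different model spaces. The smoothness of the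
transition maps is the separate requirement `IsLCManifold`. -/
class LCChartedSpace.{a, b} (M : Type b) [TopologicalSpace M] : Type (max b (a + 1)) where
  atlas : Set (LCChart.{a} M)
  chartAt : M → LCChart.{a} M
  mem_chart_source : ∀ x, x ∈ (chartAt x).toHomeo.source
  chart_mem_atlas : ∀ x, chartAt x ∈ atlas

/-- `M` is a smooth (Hausdorff) manifold modelled on locally convex spaces. -/
structure IsLCManifold.{a, b} (M : Type b) [TopologicalSpace M] [LCChartedSpace.{a} M] :
    Prop where
  t2 : T2Space M
  smooth_transition : ∀ c ∈ LCChartedSpace.atlas (M := M), ∀ c' ∈ LCChartedSpace.atlas (M := M),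
    LCChart.SmoothTransition.{a} c c'

/-- The maximal atlas: all charts that are smoothly compatible with the atlas. -/
def maxAtlas.{a, b} (M : Type b) [TopologicalSpace M] [LCChartedSpace.{a} M] :
    Set (LCChart.{a} M) :=
  {c | ∀ c' ∈ LCChartedSpace.atlas (M := M), c.SmoothTransition c' ∧ c'.SmoothTransition c}

/-- The tangent space `T_x M`, realised as the model space of the preferred chart at `x`. -/
def TangentLC.{a, b} {M : Type b} [TopologicalSpace M] (c : LCChartedSpace.{a} M) (x : M) :
    LCSpace.{a} :=
  (c.chartAt x).model

/-- The product manifold. -/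
instance instLCChartedSpaceProd.{a, b, c} (M : Type b) (N : Type c) [TopologicalSpace M]
    [TopologicalSpace N] [LCChartedSpace.{a} M] [LCChartedSpace.{a} N] :
    LCChartedSpace.{a} (M × N) where
  atlas := {e | ∃ c ∈ LCChartedSpace.atlas (M := M), ∃ d ∈ LCChartedSpace.atlas (M := N),
    e = ⟨LCSpace.prod c.model d.model, c.toHomeo.prod d.toHomeo⟩}
  chartAt p := ⟨LCSpace.prod (LCChartedSpace.chartAt p.1).model (LCChartedSpace.chartAt p.2).model,
    (LCChartedSpace.chartAt p.1).toHomeo.prod (LCChartedSpace.chartAt p.2).toHomeo⟩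
  mem_chart_source p :=
    ⟨LCChartedSpace.mem_chart_source p.1, LCChartedSpace.mem_chart_source p.2⟩
  chart_mem_atlas p := ⟨_, LCChartedSpace.chart_mem_atlas p.1, _,
    LCChartedSpace.chart_mem_atlas p.2, rfl⟩

/-- A locally convex space as a manifold with a single global chart. -/
instance instLCChartedSpaceModel.{a} (E : LCSpace.{a}) : LCChartedSpace.{a} E where
  atlas := {⟨E, OpenPartialHomeomorph.refl E⟩}
  chartAt _ := ⟨E, OpenPartialHomeomorph.refl E⟩
  mem_chart_source _ := mem_univ _
  chart_mem_atlas _ := rfl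

/-- The map `f` between manifolds is smooth on the open set `s`. -/
def MSmoothOn.{a, b, c} {M : Type b} {N : Type c} [TopologicalSpace M] [TopologicalSpace N]
    [LCChartedSpace.{a} M] [LCChartedSpace.{a} N] (f : M → N) (s : Set M) : Prop :=
  ContinuousOn f s ∧
    ∀ c ∈ LCChartedSpace.atlas (M := M), ∀ d ∈ LCChartedSpace.atlas (M := N),
      IsSmoothOn (d.toHomeo ∘ f ∘ c.toHomeo.symm)
        (c.toHomeo.target ∩ c.toHomeo.symm ⁻¹' (s ∩ f ⁻¹' d.toHomeo.source))

/-- The map `f` restricts to a diffeomorphism from the open set `s` onto the open set `f '' s`. -/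
structure IsDiffeoOn.{a, b, c} {M : Type b} {N : Type c} [TopologicalSpace M] [TopologicalSpace N]
    [LCChartedSpace.{a} M] [LCChartedSpace.{a} N] (f : M → N) (s : Set M) : Prop where
  isOpen_source : IsOpen s
  isOpen_image : IsOpen (f '' s)
  smooth : MSmoothOn f s
  smooth_inverse : ∃ g : N → M, LeftInvOn g f s ∧ MSmoothOn g (f '' s)

/-! ## Submanifolds -/

/-- The chart `φ` is adapted to the subset `S`: in it, `S` is the closed linear subspace `F`. -/
def LCChart.IsAdapted.{a, b} {M : Type b} [TopologicalSpace M] (φ : LCChart.{a} M)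
    (F : Submodule ℝ φ.model) (S : Set M) : Prop :=
  IsClosed (F : Set φ.model) ∧
    φ.toHomeo '' (φ.toHomeo.source ∩ S) = φ.toHomeo.target ∩ (F : Set φ.model)

/-- `S` is an (embedded) submanifold of `M`. -/
def IsSubmanifold.{a, b} {M : Type b} [TopologicalSpace M] [LCChartedSpace.{a} M] (S : Set M) :
    Prop :=
  ∀ x ∈ S, ∃ φ ∈ maxAtlas.{a} M, x ∈ φ.toHomeo.source ∧ ∃ F, φ.IsAdapted F S

theorem LCChart.IsAdapted.apply_mem.{a, b} {M : Type b} [TopologicalSpace M] {φ : LCChart.{a} M}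
    {F : Submodule ℝ φ.model} {S : Set M} (h : φ.IsAdapted F S) (s : S)
    (hs : (s : M) ∈ φ.toHomeo.source) : φ.toHomeo (s : M) ∈ F := by
  have : φ.toHomeo (s : M) ∈ φ.toHomeo '' (φ.toHomeo.source ∩ S) :=
    mem_image_of_mem _ ⟨hs, s.2⟩
  rw [h.2] at this
  exact this.2

theorem LCChart.IsAdapted.symm_mem.{a, b} {M : Type b} [TopologicalSpace M] {φ : LCChart.{a} M}
    {F : Submodule ℝ φ.model} {S : Set M} (h : φ.IsAdapted F S) (x : F)
    (hx : (x : φ.model) ∈ φ.toHomeo.target) : φ.toHomeo.symm (x : φ.model) ∈ S := by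
  have hx' : (x : φ.model) ∈ φ.toHomeo.target ∩ (F : Set φ.model) := ⟨hx, x.2⟩
  rw [← h.2] at hx'
  obtain ⟨y, ⟨hy, hyS⟩, hyx⟩ := hx'
  rw [← hyx, φ.toHomeo.left_inv hy]
  exact hyS

open Classical in
/-- The homeomorphism from an open subset of `S` onto an open subset of `F` obtained by restricting
an adapted chart (`s₀` is only used as a junk value outside the target). -/
def LCChart.restrictHomeo.{a, b} {M : Type b} [TopologicalSpace M] (φ : LCChart.{a} M)
    (F : Submodule ℝ φ.model) {S : Set M} (h : φ.IsAdapted F S) (s₀ : S) :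
    OpenPartialHomeomorph S F where
  toFun := fun s => if hs : φ.toHomeo (s : M) ∈ F then ⟨φ.toHomeo (s : M), hs⟩ else 0
  invFun := fun x => if hx : φ.toHomeo.symm (x : φ.model) ∈ S then ⟨_, hx⟩ else s₀
  source := (Subtype.val : S → M) ⁻¹' φ.toHomeo.source
  target := (Subtype.val : F → φ.model) ⁻¹' φ.toHomeo.target
  map_source' := by
    intro s hs
    simp only [mem_preimage, dif_pos (h.apply_mem s hs)]
    exact φ.toHomeo.map_source hs
  map_target' := by
    intro x hx
    simp only [mem_preimage, dif_pos (h.symm_mem x hx)]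
    exact φ.toHomeo.map_target hx
  left_inv' := by
    intro s hs
    have e : φ.toHomeo.symm (φ.toHomeo (s : M)) = s := φ.toHomeo.left_inv hs
    simp [dif_pos (h.apply_mem s hs), e]
  right_inv' := by
    intro x hx
    have e : φ.toHomeo (φ.toHomeo.symm (x : φ.model)) = x := φ.toHomeo.right_inv hx
    simp [dif_pos (h.symm_mem x hx), e]
  continuousOn_toFun := by
    refine Topology.IsInducing.subtypeVal.continuousOn_iff.2 ?_
    refine ContinuousOn.congr (f := fun s : S => φ.toHomeo (s : M)) ?_ ?_
    · exact φ.toHomeo.continuousOn.comp continuous_subtype_val.continuousOn fun s hs => hs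
    · intro s hs
      simp only [Function.comp, dif_pos (h.apply_mem s hs)]
  continuousOn_invFun := by
    refine Topology.IsInducing.subtypeVal.continuousOn_iff.2 ?_
    refine ContinuousOn.congr (f := fun x : F => φ.toHomeo.symm (x : φ.model)) ?_ ?_
    · exact φ.toHomeo.continuousOn_symm.comp continuous_subtype_val.continuousOn fun x hx => hx
    · intro x hx
      simp only [Function.comp, dif_pos (h.symm_mem x hx)]
  open_source := φ.toHomeo.open_source.preimage continuous_subtype_val
  open_target := φ.toHomeo.open_target.preimage continuous_subtype_val

/-- The chart of `S` obtained by restricting an adapted chart. -/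
def LCChart.restrict.{a, b} {M : Type b} [TopologicalSpace M] (φ : LCChart.{a} M)
    (F : Submodule ℝ φ.model) {S : Set M} (h : φ.IsAdapted F S) (s₀ : S) : LCChart.{a} S :=
  ⟨φ.model.sub F, φ.restrictHomeo F h s₀⟩

/-- The induced manifold structure of a submanifold: its charts are the restrictions of the
adapted charts. -/
@[reducible] def IsSubmanifold.charted.{a, b} {M : Type b} [TopologicalSpace M]
    [LCChartedSpace.{a} M] {S : Set M} (hS : IsSubmanifold.{a} S) : LCChartedSpace.{a} S where
  atlas := {c | ∃ φ ∈ maxAtlas.{a} M, ∃ (F : Submodule ℝ φ.model) (h : φ.IsAdapted F S) (s₀ : S),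
    c = φ.restrict F h s₀}
  chartAt x := (hS x x.2).choose.restrict _ (hS x x.2).choose_spec.2.2.choose_spec x
  mem_chart_source x := (hS x x.2).choose_spec.2.1
  chart_mem_atlas x := ⟨_, (hS x x.2).choose_spec.1, _, _, x, rfl⟩

/-! ## Lie groups and their actions -/

/-- `G` is a Lie group modelled on locally convex spaces. -/
structure IsLCLieGroup.{a, b} (G : Type b) [Group G] [TopologicalSpace G] [LCChartedSpace.{a} G] :
    Prop where
  manifold : IsLCManifold.{a} G
  smooth_mul : MSmoothOn.{a} (fun p : G × G => p.1 * p.2) univ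
  smooth_inv : MSmoothOn.{a} (fun g : G => g⁻¹) univ

/-- `M` is a `G`-manifold: a manifold with a smooth action of `G`. -/
structure IsGManifold.{a, b, c} (G : Type b) (M : Type c) [Group G] [TopologicalSpace G]
    [LCChartedSpace.{a} G] [TopologicalSpace M] [LCChartedSpace.{a} M] [MulAction G M] :
    Prop where
  manifold : IsLCManifold.{a} M
  smooth_smul : MSmoothOn.{a} (fun p : G × M => p.1 • p.2) univ

/-- The action is proper: preimages of compact sets under `(g, m) ↦ (g • m, m)` are compact. -/
def IsProperAction (G M : Type*) [Group G] [TopologicalSpace G] [TopologicalSpace M]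
    [MulAction G M] : Prop :=
  ∀ K : Set (M × M), IsCompact K → IsCompact ((fun p : G × M => (p.1 • p.2, p.2)) ⁻¹' K)

/-- The manifold structure `c` on `G ⧸ H` makes `G → G ⧸ H` a smooth principal `H`-bundle: near
every point of the base there is a smooth local section `σ` for which `(q, h) ↦ σ q * h` is a
diffeomorphism onto the part of `G` over the domain of `σ` (a local trivialisation). -/
structure IsPrincipalFibration.{a, b} {G : Type b} [Group G] [TopologicalSpace G]
    [LCChartedSpace.{a} G] (H : Subgroup G) (hH : IsSubmanifold.{a} (H : Set G))
    (c : LCChartedSpace.{a} (G ⧸ H)) : Prop where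
  manifold : IsLCManifold.{a} (G ⧸ H)
  smooth_proj : MSmoothOn.{a} (fun g : G => (g : G ⧸ H)) univ
  locally_trivial : ∀ q : G ⧸ H, ∃ (U : Set (G ⧸ H)) (σ : G ⧸ H → G),
    IsOpen U ∧ q ∈ U ∧ MSmoothOn.{a} σ U ∧ (∀ u ∈ U, (σ u : G ⧸ H) = u) ∧
      (letI : LCChartedSpace.{a} (H : Set G) := hH.charted
       IsDiffeoOn.{a} (fun p : (G ⧸ H) × (H : Set G) => σ p.1 * (p.2 : G)) (U ×ˢ univ))

/-! ## Orbit types -/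

/-- Conjugacy of subgroups. -/
def subgroupConj (G : Type*) [Group G] : Setoid (Subgroup G) where
  r H K := ∃ a : G, H.map (MulAut.conj a).toMonoidHom = K
  iseqv :=
    { refl := fun H => ⟨1, by ext; simp⟩
      symm := by
        rintro H K ⟨a, rfl⟩
        refine ⟨a⁻¹, ?_⟩
        ext x
        simp [Subgroup.mem_map, mul_assoc]
      trans := by
        rintro H K L ⟨a, rfl⟩ ⟨b, rfl⟩
        refine ⟨b * a, ?_⟩
        ext x
        simp [Subgroup.mem_map, mul_assoc] }

/-- Conjugacy classes `(H)` of subgroups of `G`. -/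
def OrbitTypeClass (G : Type*) [Group G] : Type _ := Quotient (subgroupConj G)

/-- The conjugacy class `(H)` of `H`. -/
def orbitTypeClass {G : Type*} [Group G] (H : Subgroup G) : OrbitTypeClass G :=
  Quotient.mk (subgroupConj G) H

/-- `(H) ≤ (H')` if and only if `K ≤ K'` for some representatives. -/
instance (G : Type*) [Group G] : LE (OrbitTypeClass G) where
  le κ η := ∃ K K' : Subgroup G, orbitTypeClass K = κ ∧ orbitTypeClass K' = η ∧ K ≤ K'

/-- The orbit type `(G_m)` of a point `m`. -/
def orbitType (G : Type*) {M : Type*} [Group G] [MulAction G M] (m : M) : OrbitTypeClass G :=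
  orbitTypeClass (MulAction.stabilizer G m)

/-- The set `M_{(H)}` of points of orbit type `(H)`. -/
def orbitTypeSet {G : Type*} (M : Type*) [Group G] [MulAction G M] (κ : OrbitTypeClass G) :
    Set M :=
  {m | orbitType G m = κ}

/-- The set `M_{≥ (H)}`. -/
def orbitTypeSetGE {G : Type*} (M : Type*) [Group G] [MulAction G M] (κ : OrbitTypeClass G) :
    Set M :=
  {m | κ ≤ orbitType G m}

/-- The orbit types of the action: conjugacy classes of stabilizer subgroups. -/
def OrbitTypes (G M : Type*) [Group G] [MulAction G M] : Type _ :=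
  {κ : OrbitTypeClass G // ∃ m : M, orbitType G m = κ}

/-! ## Slices -/

/-- `S` is a slice at `m` for the action of `G` on `M`. -/
structure IsSlice.{a, b, c} (G : Type b) {M : Type c} [Group G] [TopologicalSpace G]
    [LCChartedSpace.{a} G] [TopologicalSpace M] [LCChartedSpace.{a} M] [MulAction G M]
    (S : Set M) (m : M) : Prop where
  mem : m ∈ S
  submanifold : IsSubmanifold.{a} S
  invariant : ∀ g ∈ MulAction.stabilizer G m, ∀ s ∈ S, g • s ∈ S
  mem_stabilizer : ∀ g : G, (∃ s ∈ S, g • s ∈ S) → g ∈ MulAction.stabilizer G m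
  stabilizer_submanifold : IsSubmanifold.{a} (MulAction.stabilizer G m : Set G)
  /-- The stabilizer is principal, and `(q, s) ↦ χ q • s` is a diffeomorphism `U × S → V`. -/
  local_product : ∃ c : LCChartedSpace.{a} (G ⧸ MulAction.stabilizer G m),
    IsPrincipalFibration (MulAction.stabilizer G m) stabilizer_submanifold c ∧
    ∃ (U : Set (G ⧸ MulAction.stabilizer G m)) (χ : G ⧸ MulAction.stabilizer G m → G),
      IsOpen U ∧ ((1 : G) : G ⧸ MulAction.stabilizer G m) ∈ U ∧ MSmoothOn.{a} χ U ∧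
      (∀ u ∈ U, (χ u : G ⧸ MulAction.stabilizer G m) = u) ∧
      (letI : LCChartedSpace.{a} S := submanifold.charted
       IsDiffeoOn.{a} (fun p : (G ⧸ MulAction.stabilizer G m) × S => χ p.1 • (p.2 : M))
         (U ×ˢ univ)) ∧
      m ∈ (fun p : (G ⧸ MulAction.stabilizer G m) × S => χ p.1 • (p.2 : M)) '' (U ×ˢ univ)
  /-- The partial slice `S_{(G_m)}` is a closed submanifold of `S`. -/
  partial_slice :
    IsClosed {s : S | orbitType G (s : M) = orbitType G m} ∧
    (letI : LCChartedSpace.{a} S := submanifold.charted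
     IsSubmanifold.{a} {s : S | orbitType G (s : M) = orbitType G m})

/-- The action of the stabilizer `G_m` on a slice at `m`. -/
@[reducible] def IsSlice.action.{a, b, c} {G : Type b} {M : Type c} [Group G] [TopologicalSpace G]
    [LCChartedSpace.{a} G] [TopologicalSpace M] [LCChartedSpace.{a} M] [MulAction G M]
    {S : Set M} {m : M} (hS : IsSlice.{a} G S m) : MulAction (MulAction.stabilizer G m) S where
  smul g s := ⟨(g : G) • (s : M), hS.invariant g g.2 s s.2⟩
  one_smul s := Subtype.ext (one_smul G (s : M))
  mul_smul g h s := Subtype.ext (mul_smul (g : G) (h : G) (s : M))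

/-- `S` is a linear slice at `m`: it is equivariantly diffeomorphic to an invariant open
neighbourhood `O` of `0` in a continuous representation `X` of `G_m`. -/
structure IsLinearSlice.{a, b, c} (G : Type b) {M : Type c} [Group G] [TopologicalSpace G]
    [LCChartedSpace.{a} G] [TopologicalSpace M] [LCChartedSpace.{a} M] [MulAction G M]
    (S : Set M) (m : M) : Prop extends IsSlice.{a} G S m where
  linear : ∃ (X : LCSpace.{a}) (ρ : Representation ℝ (MulAction.stabilizer G m) X)
    (O : Set X) (ι : X → S),
      Continuous (fun p : MulAction.stabilizer G m × X => ρ p.1 p.2) ∧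
      IsOpen O ∧ (0 : X) ∈ O ∧ (∀ g, ∀ x ∈ O, ρ g x ∈ O) ∧
      (letI : LCChartedSpace.{a} S := submanifold.charted
       IsDiffeoOn.{a} ι O) ∧
      ι '' O = univ ∧ (ι 0 : M) = m ∧
      ∀ g : MulAction.stabilizer G m, ∀ x ∈ O, (ι (ρ g x) : M) = (g : G) • (ι x : M)

/-- The `G_m`-manifold `S` (for a slice `S` at `m`) admits a linear slice at every point. -/
def IsSlice.AdmitsLinearSlices.{a, b, c} {G : Type b} {M : Type c} [Group G] [TopologicalSpace G]
    [LCChartedSpace.{a} G] [TopologicalSpace M] [LCChartedSpace.{a} M] [MulAction G M]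
    {S : Set M} {m : M} (hS : IsSlice.{a} G S m) : Prop :=
  letI : LCChartedSpace.{a} (MulAction.stabilizer G m) := hS.stabilizer_submanifold.charted
  letI : LCChartedSpace.{a} S := hS.submanifold.charted
  letI : MulAction (MulAction.stabilizer G m) S := hS.action
  ∀ s : S, ∃ T : Set S, IsLinearSlice.{a} (MulAction.stabilizer G m) T s

/-! ## Stratifications -/

/-- `X i` is a frontier stratum of `X j`. -/
def FrontierLT {X ι : Type*} [TopologicalSpace X] (P : ι → Set X) (i j : ι) : Prop :=
  i ≠ j ∧ (P i ∩ closure (P j)).Nonempty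

/-- The family `P` of subsets of `X`, with the manifold structures `c i` (inducing the subspace
topology), is a stratification of `X`. -/
structure IsStratification.{a, b, d} {X : Type b} {ι : Type d} [TopologicalSpace X]
    (P : ι → Set X) (c : ∀ i, LCChartedSpace.{a} (P i)) : Prop where
  t2 : T2Space X
  nonempty : ∀ i, (P i).Nonempty
  disjoint : ∀ i j, i ≠ j → Disjoint (P i) (P j)
  cover : ⋃ i, P i = univ
  locallyClosed : ∀ i, IsLocallyClosed (P i)
  manifold : ∀ i, IsLCManifold.{a} (P i)
  frontier_subset : ∀ i j, FrontierLT P i j → P i ⊆ closure (P j) \ P j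
  frontier_disjoint : ∀ i j, FrontierLT P i j → Disjoint (P j) (closure (P i))

/-- Smooth regularity of a family of strata. -/
def IsSmoothlyRegular.{a, b, d} {X : Type b} {ι : Type d} [TopologicalSpace X]
    (P : ι → Set X) (c : ∀ i, LCChartedSpace.{a} (P i)) : Prop :=
  ∀ i j, FrontierLT P i j → ∀ x : P i, ∃ U : Set X, IsOpen U ∧ (x : X) ∈ U ∧
    ∀ y : P j, (y : X) ∈ U →
      ∃ f : TangentLC (c i) x →L[ℝ] TangentLC (c j) y, Function.Injective f

end

set_option linter.unusedSectionVars false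

/-! ## Michal–Bastiani calculus -/

section Calculus

variable {E F H : Type*}
  [AddCommGroup E] [Module ℝ E] [TopologicalSpace E]
  [AddCommGroup F] [Module ℝ F] [TopologicalSpace F]
  [AddCommGroup H] [Module ℝ H] [TopologicalSpace H]

/-! Everything is read off from one chart. A linear slice at `m` identifies a neighbourhood of `m`
with a product of an open piece of `G ⧸ G_m` and an open set `O` in a representation `X` of `G_m`.
Moving along the first factor is the action of a group element, so the orbit type depends only on
the coordinate `x ∈ O`. By the slice axioms and equivariance, the stabilizer of the point with
coordinate `x` in the slice is the isotropy group of `x` under the linear action. That group does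
not change when a `G_m`-fixed vector is added to `x`. Hence every orbit type is invariant under
translation along `F`, the full first factor times the invariants of `X`.

The stratum of `m` is exactly `F` in this chart. A point of the slice has stabilizer inside `G_m`;
if that stabilizer is also conjugate to `G_m`, it must be all of `G_m`, so its coordinate is
invariant. This rests on `Subgroup.exists_conj_eq_of_isCompact`. Properness makes `G_m` compact,
hence modelled on a finite-dimensional space with finitely many components. A conjugation mapping it
into itself is an injective homomorphism with injective derivative at the identity, hence open by
the inverse function theorem. Its image is open and closed, and counting components gives
surjectivity.

`IsLinearSlice.exists_chart` collects these facts. It shows that the strata are submanifolds. Near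
`m`, translation along `F` stays in each stratum, so differentiating changes of charts gives
injections from the tangent space at `m` into `F` and from `F` into the tangent space at a nearby
`v`. Orbit types near `m` are at most that of `m`. With the approximation property this gives the
frontier condition, and antisymmetry of the order at orbit types, again by compactness, excludes
mutual adherence of distinct strata.

The calculus serves to provide the chain rule and strict derivatives, which in finite dimensions
become strict Fréchet derivatives. -/

theorem tendsto_add_smul [IsTopologicalAddGroup E] [ContinuousSMul ℝ E] (x v : E) :
    Tendsto (fun t : ℝ => x + t • v) (𝓝[≠] 0) (𝓝 x) := by
  have h : Continuous fun t : ℝ => x + t • v := by fun_prop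
  simpa using (h.tendsto 0).mono_left nhdsWithin_le_nhds

theorem HasDirDeriv.congr [IsTopologicalAddGroup E] [ContinuousSMul ℝ E] {f g : E → F} {w : F}
    {x v : E} (h : HasDirDeriv f w x v) (hfg : f =ᶠ[𝓝 x] g) : HasDirDeriv g w x v := by
  refine Tendsto.congr' ?_ h
  filter_upwards [(tendsto_add_smul x v).eventually hfg] with t ht
  rw [ht, hfg.self_of_nhds]

theorem HasDirDeriv.unique [T2Space F] {f : E → F} {w w' : F} {x v : E}
    (h : HasDirDeriv f w x v) (h' : HasDirDeriv f w' x v) : w = w' :=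
  tendsto_nhds_unique h h'

theorem HasDirDeriv.prodMk {f : E → F} {g : E → H} {w : F} {w' : H} {x v : E}
    (h : HasDirDeriv f w x v) (h' : HasDirDeriv g w' x v) :
    HasDirDeriv (fun y => (f y, g y)) (w, w') x v :=
  Tendsto.prodMk_nhds h h'

theorem ContinuousLinearMap.hasDirDeriv (L : E →L[ℝ] F) (x v : E) : HasDirDeriv L (L v) x v := by
  refine tendsto_const_nhds.congr' ?_
  filter_upwards [self_mem_nhdsWithin] with t ht
  rw [map_add, map_smul, add_sub_cancel_left, smul_smul, inv_mul_cancel₀ ht, one_smul]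

theorem hasDirDeriv_const (c : F) (x v : E) : HasDirDeriv (fun _ : E => c) 0 x v := by
  simpa [HasDirDeriv] using tendsto_const_nhds

theorem HasDirDeriv.smul_right [ContinuousConstSMul ℝ F] {f : E → F} {w : F} {x v : E}
    (h : HasDirDeriv f w x v) (c : ℝ) : HasDirDeriv f (c • w) x (c • v) := by
  rcases eq_or_ne c 0 with rfl | hc
  · simpa [HasDirDeriv] using tendsto_const_nhds
  have ht : Tendsto (fun t : ℝ => t * c) (𝓝[≠] 0) (𝓝[≠] 0) := by
    refine tendsto_nhdsWithin_iff.2 ⟨?_, ?_⟩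
    · have : Continuous fun t : ℝ => t * c := by fun_prop
      simpa using (this.tendsto 0).mono_left nhdsWithin_le_nhds
    · filter_upwards [self_mem_nhdsWithin] with t ht using mul_ne_zero ht hc
  refine ((Tendsto.comp h ht).const_smul c).congr fun t => ?_
  simp only [Function.comp, smul_smul]
  rw [mul_inv, mul_comm t⁻¹, ← mul_assoc, mul_inv_cancel₀ hc, one_mul]

theorem IsCk.continuousOn : ∀ {n : ℕ} {f : E → F} {U : Set E}, IsCk n f U → ContinuousOn f U
  | 0, _, _, h => h
  | _ + 1, _, _, h => h.1

theorem IsCk.mono.{a} : ∀ {n : ℕ} {E : Type a} [AddCommGroup E] [Module ℝ E] [TopologicalSpace E]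
    {f : E → F} {U V : Set E}, IsCk n f U → V ⊆ U → IsCk n f V
  | 0, _, _, _, _, _, _, _, h, hV => ContinuousOn.mono h hV
  | _ + 1, _, _, _, _, _, _, _, ⟨h, df, hdf, hk⟩, hV =>
    ⟨h.mono hV, df, fun x hx => hdf x (hV hx), IsCk.mono hk (prod_mono hV subset_rfl)⟩

theorem IsCk.congr.{a} : ∀ {n : ℕ} {E : Type a} [AddCommGroup E] [Module ℝ E] [TopologicalSpace E]
    [IsTopologicalAddGroup E] [ContinuousSMul ℝ E]
    {f g : E → F} {U : Set E}, IsCk n f U → IsOpen U → EqOn f g U → IsCk n g U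
  | 0, _, _, _, _, _, _, _, _, _, h, _, hfg => ContinuousOn.congr h hfg.symm
  | _ + 1, _, _, _, _, _, _, _, _, _, ⟨h, df, hdf, hk⟩, hU, hfg =>
    ⟨h.congr hfg.symm, df, fun x hx v =>
      (hdf x hx v).congr (hfg.eventuallyEq_of_mem (hU.mem_nhds hx)), hk⟩

theorem IsCk.of_succ.{a} : ∀ {n : ℕ} {E : Type a} [AddCommGroup E] [Module ℝ E]
    [TopologicalSpace E] {f : E → F} {U : Set E}, IsCk (n + 1) f U → IsCk n f U
  | 0, _, _, _, _, _, _, h => h.1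
  | _ + 1, _, _, _, _, _, _, ⟨h, df, hdf, hk⟩ => ⟨h, df, hdf, IsCk.of_succ hk⟩

open Classical in
-- The definition asks for a single `df` on all of `U`. It is chosen as the limit of the difference
-- quotients wherever that limit exists; since limits in `F` are unique, it agrees with each local
-- derivative.
theorem IsCk.of_locally.{a} [T2Space F] : ∀ {n : ℕ} {E : Type a} [AddCommGroup E] [Module ℝ E]
    [TopologicalSpace E] [IsTopologicalAddGroup E] [ContinuousSMul ℝ E] {f : E → F} {U : Set E},
    (∀ x ∈ U, ∃ W, IsOpen W ∧ x ∈ W ∧ IsCk n f W) → IsCk n f U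
  | 0, _, _, _, _, _, _, _, _, h => fun x hx => by
    obtain ⟨W, hW, hxW, hf⟩ := h x hx
    exact (ContinuousOn.continuousAt hf (hW.mem_nhds hxW)).continuousWithinAt
  | n + 1, E, _, _, _, _, _, f, U, h => by
    refine ⟨fun x hx => ?_, fun p => if h : ∃ w, HasDirDeriv f w p.1 p.2 then h.choose else 0,
      fun x hx v => ?_, IsCk.of_locally ?_⟩
    · obtain ⟨W, hW, hxW, hf⟩ := h x hx
      exact (hf.1.continuousAt (hW.mem_nhds hxW)).continuousWithinAt
    · obtain ⟨W, hW, hxW, -, df, hdf, -⟩ := h x hx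
      have : ∃ w, HasDirDeriv f w (x, v).1 (x, v).2 := ⟨_, hdf x hxW v⟩
      simp only [dif_pos this]
      exact this.choose_spec
    · rintro ⟨x, v⟩ ⟨hx, -⟩
      obtain ⟨W, hW, hxW, -, df, hdf, hk⟩ := h x hx
      refine ⟨W ×ˢ univ, hW.prod isOpen_univ, ⟨hxW, trivial⟩,
        hk.congr (hW.prod isOpen_univ) ?_⟩
      rintro ⟨y, u⟩ ⟨hy, -⟩
      have : ∃ w, HasDirDeriv f w (y, u).1 (y, u).2 := ⟨_, hdf y hy u⟩
      simp only [dif_pos this]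
      exact (hdf y hy u).unique this.choose_spec

theorem IsCk.prodMk.{a} : ∀ {n : ℕ} {E : Type a} [AddCommGroup E] [Module ℝ E]
    [TopologicalSpace E] {f : E → F} {g : E → H} {U : Set E}, IsCk n f U → IsCk n g U →
    IsCk n (fun x => (f x, g x)) U
  | 0, _, _, _, _, _, _, _, hf, hg => ContinuousOn.prodMk hf hg
  | _ + 1, _, _, _, _, _, _, _, ⟨hf, df, hdf, hkf⟩, ⟨hg, dg, hdg, hkg⟩ =>
    ⟨hf.prodMk hg, fun p => (df p, dg p), fun x hx v => (hdf x hx v).prodMk (hdg x hx v),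
      IsCk.prodMk hkf hkg⟩

theorem ContinuousLinearMap.isCk.{a} : ∀ (n : ℕ) {E : Type a} [AddCommGroup E] [Module ℝ E]
    [TopologicalSpace E] (L : E →L[ℝ] F) (U : Set E), IsCk n L U
  | 0, _, _, _, _, L, _ => L.continuous.continuousOn
  | n + 1, E, _, _, _, L, _ => ⟨L.continuous.continuousOn, L.comp (ContinuousLinearMap.snd ℝ E E),
      fun x _ v => L.hasDirDeriv x v, ContinuousLinearMap.isCk n _ _⟩

theorem isCk_const.{a} : ∀ (n : ℕ) {E : Type a} [AddCommGroup E] [Module ℝ E]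
    [TopologicalSpace E] (c : F) (U : Set E), IsCk n (fun _ : E => c) U
  | 0, _, _, _, _, _, _ => continuousOn_const
  | n + 1, _, _, _, _, c, _ => ⟨continuousOn_const, fun _ => 0,
      fun x _ v => hasDirDeriv_const c x v, isCk_const n _ _⟩

/-- A `C^1` map has strict directional derivatives. -/
theorem tendsto_strict_of_hasDirDeriv [IsTopologicalAddGroup E] [ContinuousSMul ℝ E]
    [IsTopologicalAddGroup F] [ContinuousSMul ℝ F] [LocallyConvexSpace ℝ F]
    {f : E → F} {U : Set E} (hU : IsOpen U) {df : E × E → F}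
    (hdf : ∀ x ∈ U, ∀ v, HasDirDeriv f (df (x, v)) x v)
    (hc : ContinuousOn df (U ×ˢ univ)) {x : E} (hx : x ∈ U) (v : E) :
    Tendsto (fun p : ℝ × E × E => p.1⁻¹ • (f (p.2.1 + p.1 • p.2.2) - f p.2.1))
      (𝓝[≠] 0 ×ˢ 𝓝 (x, v)) (𝓝 (df (x, v))) := by
  intro N hN
  -- Mean value argument: once `df` stays in the interior of a convex `C` along the segment, the
  -- difference quotient lies there too. Otherwise Hahn–Banach separates it from that interior by
  -- some `l`, and the scalar mean value theorem for `l ∘ f` on the segment contradicts the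
  -- separation.
  obtain ⟨C, ⟨hC, hCc⟩, hCN⟩ := (LocallyConvexSpace.convex_basis (𝕜 := ℝ) (df (x, v))).mem_iff.1 hN
  have hq : Continuous fun p : ℝ × E × E => (p.2.1 + p.1 • p.2.2, p.2.2) := by fun_prop
  have h0 : ((x, v) : E × E) = (fun p : ℝ × E × E => (p.2.1 + p.1 • p.2.2, p.2.2)) (0, x, v) := by
    simp
  have hCx : df ⁻¹' interior C ∈ 𝓝 (x, v) :=
    (hc.continuousAt ((hU.prod isOpen_univ).mem_nhds ⟨hx, trivial⟩))
      (isOpen_interior.mem_nhds (mem_interior_iff_mem_nhds.2 hC))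
  have hUx : U ×ˢ univ ∈ 𝓝 (x, v) := (hU.prod isOpen_univ).mem_nhds ⟨hx, trivial⟩
  have hev := hq.continuousAt.preimage_mem_nhds (h0 ▸ inter_mem hCx hUx)
  rw [nhds_prod_eq] at hev
  obtain ⟨A, hA, B, hB, hAB⟩ := mem_prod_iff.1 hev
  obtain ⟨δ, hδ, hδA⟩ := Metric.mem_nhds_iff.1 hA
  have hA' : Metric.ball (0 : ℝ) δ ∩ {0}ᶜ ∈ 𝓝[≠] (0 : ℝ) := by
    rw [inter_comm]; exact inter_mem_nhdsWithin _ (Metric.ball_mem_nhds _ hδ)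
  refine mem_map.2 (mem_of_superset (prod_mem_prod hA' hB) ?_)
  rintro ⟨t, y, w⟩ ⟨⟨ht, ht0⟩, hyw⟩
  refine hCN (interior_subset ?_)
  by_contra hnot
  obtain ⟨l, hl⟩ := geometric_hahn_banach_open_point hCc.interior isOpen_interior hnot
  have hmem : ∀ s ∈ Icc (0 : ℝ) 1, (y + (t * s) • w ∈ U ∧ df (y + (t * s) • w, w) ∈ interior C) := by
    intro s hs
    have : t * s ∈ Metric.ball (0 : ℝ) δ := by
      rw [mem_ball_zero_iff, norm_mul] at *
      refine lt_of_le_of_lt (mul_le_of_le_one_right (norm_nonneg _) ?_) ht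
      rw [Real.norm_of_nonneg hs.1]; exact hs.2
    have := hAB (show (t * s, y, w) ∈ A ×ˢ B from ⟨hδA this, hyw⟩)
    exact ⟨this.2.1, this.1⟩
  have hder : ∀ s ∈ Icc (0 : ℝ) 1, HasDerivAt (fun s : ℝ => l (f (y + (t * s) • w)))
      (t * l (df (y + (t * s) • w, w))) s := by
    intro s hs
    have h1 : HasDirDeriv f (t • df (y + (t * s) • w, w)) (y + (t * s) • w) (t • w) :=
      (hdf _ (hmem s hs).1 w).smul_right t
    rw [hasDerivAt_iff_tendsto_slope_zero]
    have h2 := (l.continuous.tendsto _).comp h1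
    rw [map_smul, smul_eq_mul] at h2
    refine h2.congr fun r => ?_
    simp only [Function.comp, map_smul, map_sub]
    rw [add_assoc, smul_smul, ← add_smul, mul_add, mul_comm r t]
  obtain ⟨s, hs, hse⟩ := exists_hasDerivAt_eq_slope (fun s : ℝ => l (f (y + (t * s) • w)))
    (fun s => t * l (df (y + (t * s) • w, w))) one_pos
    (fun s hs => (hder s hs).continuousAt.continuousWithinAt)
    (fun s hs => hder s (Ioo_subset_Icc_self hs))
  have h3 := hl _ (hmem s (Ioo_subset_Icc_self hs)).2
  have ht0' : t ≠ 0 := ht0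
  simp only [map_smul, map_sub, smul_eq_mul] at h3
  simp only [mul_one, mul_zero, zero_smul, add_zero, sub_zero, div_one] at hse
  rw [← hse, ← mul_assoc, inv_mul_cancel₀ ht0', one_mul] at h3
  exact lt_irrefl _ h3

/-- The quotient of `g ∘ f` is the quotient of `g` at `f x` in the direction given by the quotient
of `f`. This direction varies with `t`, so a plain directional derivative of `g` would not suffice.
-/
theorem HasDirDeriv.comp_of_strict [ContinuousSMul ℝ F] [IsTopologicalAddGroup F]
    [IsTopologicalAddGroup E] [ContinuousSMul ℝ E]
    {f : E → F} {g : F → H} {w : F} {z : H} {x v : E}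
    (hf : HasDirDeriv f w x v)
    (hg : Tendsto (fun p : ℝ × F × F => p.1⁻¹ • (g (p.2.1 + p.1 • p.2.2) - g p.2.1))
      (𝓝[≠] 0 ×ˢ 𝓝 (f x, w)) (𝓝 z)) : HasDirDeriv (g ∘ f) z x v := by
  have h : Tendsto (fun t : ℝ => (t, f x, t⁻¹ • (f (x + t • v) - f x))) (𝓝[≠] 0)
      (𝓝[≠] 0 ×ˢ 𝓝 (f x, w)) :=
    tendsto_id.prodMk (tendsto_const_nhds.prodMk_nhds hf)
  refine (hg.comp h).congr' ?_
  filter_upwards [self_mem_nhdsWithin] with t ht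
  have ht' : t ≠ 0 := ht
  simp [smul_smul, mul_inv_cancel₀ ht']

/-- The induction in the chain rule needs `f ∘ fst` to be of class `C^n`. Linear inner maps are
treated separately because they require neither openness nor local convexity. -/
theorem IsCk.comp_clm.{a, b} : ∀ {n : ℕ} {E : Type a} {F : Type b} [AddCommGroup E] [Module ℝ E]
    [TopologicalSpace E] [AddCommGroup F] [Module ℝ F] [TopologicalSpace F] {g : F → H} {V : Set F},
    IsCk n g V → ∀ L : E →L[ℝ] F, IsCk n (fun x => g (L x)) (L ⁻¹' V)
  | 0, _, _, _, _, _, _, _, _, _, _, hg, L =>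
    ContinuousOn.comp hg L.continuous.continuousOn fun _ hx => hx
  | n + 1, E, F, _, _, _, _, _, _, g, V, ⟨hg, dg, hdg, hkg⟩, L => by
    refine ⟨hg.comp L.continuous.continuousOn fun _ hx => hx, fun p => dg (L.prodMap L p),
      fun x hx v => ?_, (hkg.comp_clm (L.prodMap L)).mono fun p hp => ⟨hp.1, trivial⟩⟩
    have := hdg (L x) hx (L v)
    simpa [HasDirDeriv] using this

/-- The chain rule. -/
theorem IsCk.comp.{a, b} [IsTopologicalAddGroup H] [ContinuousSMul ℝ H] [LocallyConvexSpace ℝ H] :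
    ∀ {n : ℕ} {E : Type a} {F : Type b} [AddCommGroup E] [Module ℝ E]
    [TopologicalSpace E] [IsTopologicalAddGroup E] [ContinuousSMul ℝ E] [AddCommGroup F]
    [Module ℝ F] [TopologicalSpace F] [IsTopologicalAddGroup F] [ContinuousSMul ℝ F]
    [LocallyConvexSpace ℝ F]
    {g : F → H} {f : E → F} {V : Set F} {U : Set E},
    IsCk n g V → IsCk n f U → IsOpen V → IsOpen U → MapsTo f U V → IsCk n (g ∘ f) U
  | 0, _, _, _, _, _, _, _, _, _, _, _, _, _, _, _, _, _, hg, hf, _, _, hUV =>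
    ContinuousOn.comp hg hf hUV
  | n + 1, E, F, _, _, _, _, _, _, _, _, _, _, _, g, f, V, U, ⟨hg, dg, hdg, hkg⟩,
      ⟨hf, df, hdf, hkf⟩, hV, hU, hUV => by
    refine ⟨hg.comp hf hUV, dg ∘ fun p : E × E => (f p.1, df p), fun x hx v => ?_, ?_⟩
    · exact (hdf x hx v).comp_of_strict
        (tendsto_strict_of_hasDirDeriv hV hdg hkg.continuousOn (hUV hx) _)
    · have hfk : IsCk n f U := IsCk.of_succ ⟨hf, df, hdf, hkf⟩
      refine IsCk.comp hkg (IsCk.prodMk ?_ hkf) (hV.prod isOpen_univ) (hU.prod isOpen_univ) ?_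
      · exact (hfk.comp_clm (ContinuousLinearMap.fst ℝ E E)).mono fun p hp => hp.1
      · exact fun p hp => ⟨hUV hp.1, trivial⟩

/-- A `C^n` map with values in a closed linear subspace is `C^n` as a map to that subspace. -/
theorem IsCk.codRestrict.{a} [IsTopologicalAddGroup F] [ContinuousSMul ℝ F] {A : Submodule ℝ F}
    (hA : IsClosed (A : Set F)) : ∀ {n : ℕ} {E : Type a} [AddCommGroup E] [Module ℝ E]
    [TopologicalSpace E] [IsTopologicalAddGroup E] [ContinuousSMul ℝ E] {f : E → A} {U : Set E},
    IsOpen U → IsCk n (fun x => (f x : F)) U → IsCk n f U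
  | 0, _, _, _, _, _, _, _, _, _, h =>
    Topology.IsInducing.subtypeVal.continuousOn_iff.2 h
  | n + 1, E, _, _, _, _, _, f, U, hU, ⟨h, df, hdf, hk⟩ => by
    classical
    -- Closedness of `A` enters here: the derivative is a limit of difference quotients lying in
    -- `A`.
    have hmem : ∀ p ∈ U ×ˢ (univ : Set E), df p ∈ A := by
      rintro ⟨x, v⟩ ⟨hx, -⟩
      exact hA.mem_of_tendsto (hdf x hx v)
        (Eventually.of_forall fun t => A.smul_mem _ (A.sub_mem (f _).2 (f _).2))
    refine ⟨Topology.IsInducing.subtypeVal.continuousOn_iff.2 h,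
      fun p => if hp : df p ∈ A then ⟨df p, hp⟩ else 0, fun x hx v => ?_,
      IsCk.codRestrict hA (hU.prod isOpen_univ) (hk.congr (hU.prod isOpen_univ) fun p hp => ?_)⟩
    · simp only [dif_pos (hmem (x, v) ⟨hx, trivial⟩)]
      exact tendsto_subtype_rng.2 (hdf x hx v)
    · simp only [dif_pos (hmem p hp)]

end Calculus

/-! ### Smoothness at a point, strict derivatives and the inverse function theorem. -/

section SmoothAt

variable {E F H : Type*}
  [AddCommGroup E] [Module ℝ E] [TopologicalSpace E]
  [AddCommGroup F] [Module ℝ F] [TopologicalSpace F]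
  [AddCommGroup H] [Module ℝ H] [TopologicalSpace H]

/-- `f` is smooth on some open neighbourhood of `x`. -/
def IsSmoothAt (f : E → F) (x : E) : Prop :=
  ∃ U, IsOpen U ∧ x ∈ U ∧ IsSmoothOn f U

theorem IsSmoothOn.isSmoothAt {f : E → F} {U : Set E} (h : IsSmoothOn f U) (hU : IsOpen U) {x : E}
    (hx : x ∈ U) : IsSmoothAt f x :=
  ⟨U, hU, hx, h⟩

theorem IsSmoothAt.continuousAt {f : E → F} {x : E} (h : IsSmoothAt f x) : ContinuousAt f x := by
  obtain ⟨U, hU, hx, h⟩ := h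
  exact (h 0).continuousOn.continuousAt (hU.mem_nhds hx)

theorem isSmoothOn_of_forall_isSmoothAt [IsTopologicalAddGroup E] [ContinuousSMul ℝ E] [T2Space F]
    {f : E → F} {U : Set E} (h : ∀ x ∈ U, IsSmoothAt f x) : IsSmoothOn f U := fun n =>
  IsCk.of_locally fun x hx => let ⟨W, hW, hxW, hf⟩ := h x hx; ⟨W, hW, hxW, hf n⟩

theorem IsSmoothAt.congr [IsTopologicalAddGroup E] [ContinuousSMul ℝ E] {f g : E → F} {x : E}
    (h : IsSmoothAt f x) (hfg : f =ᶠ[𝓝 x] g) : IsSmoothAt g x := by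
  obtain ⟨U, hU, hx, h⟩ := h
  obtain ⟨V, hV, hVo, hxV⟩ := mem_nhds_iff.1 hfg
  exact ⟨U ∩ V, hU.inter hVo, ⟨hx, hxV⟩, fun n =>
    ((h n).mono inter_subset_left).congr (hU.inter hVo) fun y hy => hV hy.2⟩

theorem IsSmoothAt.prodMk {f : E → F} {g : E → H} {x : E} (hf : IsSmoothAt f x)
    (hg : IsSmoothAt g x) : IsSmoothAt (fun y => (f y, g y)) x := by
  obtain ⟨U, hU, hx, hf⟩ := hf
  obtain ⟨V, hV, hxV, hg⟩ := hg
  exact ⟨U ∩ V, hU.inter hV, ⟨hx, hxV⟩, fun n =>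
    ((hf n).mono inter_subset_left).prodMk ((hg n).mono inter_subset_right)⟩

theorem ContinuousLinearMap.isSmoothAt (L : E →L[ℝ] F) (x : E) : IsSmoothAt L x :=
  ⟨univ, isOpen_univ, trivial, fun n => L.isCk n _⟩

theorem isSmoothAt_const (c : F) (x : E) : IsSmoothAt (fun _ : E => c) x :=
  ⟨univ, isOpen_univ, trivial, fun n => isCk_const n _ _⟩

theorem isSmoothAt_id (x : E) : IsSmoothAt (fun y : E => y) x :=
  (ContinuousLinearMap.id ℝ E).isSmoothAt x

theorem IsSmoothAt.comp [IsTopologicalAddGroup E] [ContinuousSMul ℝ E]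
    [IsTopologicalAddGroup F] [ContinuousSMul ℝ F] [LocallyConvexSpace ℝ F]
    [IsTopologicalAddGroup H] [ContinuousSMul ℝ H] [LocallyConvexSpace ℝ H]
    {g : F → H} {f : E → F} {x : E} (hg : IsSmoothAt g (f x)) (hf : IsSmoothAt f x) :
    IsSmoothAt (g ∘ f) x := by
  obtain ⟨U, hU, hx, hf⟩ := hf
  obtain ⟨V, hV, hxV, hg⟩ := hg
  have ho : IsOpen (U ∩ f ⁻¹' V) := (hf 0).continuousOn.isOpen_inter_preimage hU hV
  exact ⟨U ∩ f ⁻¹' V, ho, ⟨hx, hxV⟩, fun n =>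
    (hg n).comp ((hf n).mono inter_subset_left) hV ho fun y hy => hy.2⟩

theorem IsSmoothAt.codRestrict [IsTopologicalAddGroup E] [ContinuousSMul ℝ E]
    [IsTopologicalAddGroup F] [ContinuousSMul ℝ F] {A : Submodule ℝ F} (hA : IsClosed (A : Set F))
    {f : E → A} {x : E} (h : IsSmoothAt (fun y => (f y : F)) x) : IsSmoothAt f x := by
  obtain ⟨U, hU, hx, h⟩ := h
  exact ⟨U, hU, hx, fun n => (h n).codRestrict hA hU⟩

/-- The continuous linear map `D` is the derivative of `f` at `x`, in the strict sense that
difference quotients converge locally uniformly in the base point and the direction. -/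
def HasStrictDirDeriv (f : E → F) (D : E →L[ℝ] F) (x : E) : Prop :=
  ∀ v, Tendsto (fun p : ℝ × E × E => p.1⁻¹ • (f (p.2.1 + p.1 • p.2.2) - f p.2.1))
    (𝓝[≠] 0 ×ˢ 𝓝 (x, v)) (𝓝 (D v))

theorem HasStrictDirDeriv.hasDirDeriv {f : E → F} {D : E →L[ℝ] F} {x : E}
    (h : HasStrictDirDeriv f D x) (v : E) : HasDirDeriv f (D v) x v := by
  have : Tendsto (fun t : ℝ => (t, x, v)) (𝓝[≠] 0) (𝓝[≠] 0 ×ˢ 𝓝 (x, v)) :=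
    tendsto_id.prodMk tendsto_const_nhds
  exact (h v).comp this

/-- Additivity is where strictness matters: the increment along `v + w` is the increment along `v`
from `x` plus the one along `w` from the moving base point `x + t • v`. Homogeneity is a rescaling
of `t`, and continuity comes from that of `df`. -/
theorem IsSmoothAt.exists_hasStrictDirDeriv [IsTopologicalAddGroup E] [ContinuousSMul ℝ E]
    [IsTopologicalAddGroup F] [ContinuousSMul ℝ F] [LocallyConvexSpace ℝ F] [T2Space F]
    {f : E → F} {x : E} (h : IsSmoothAt f x) : ∃ D : E →L[ℝ] F, HasStrictDirDeriv f D x := by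
  obtain ⟨U, hU, hx, h⟩ := h
  obtain ⟨-, df, hdf, hc⟩ := h 1
  have hc : ContinuousOn df (U ×ˢ univ) := hc
  have key := fun v => tendsto_strict_of_hasDirDeriv hU hdf hc hx v
  refine ⟨⟨⟨⟨fun v => df (x, v), fun v w => ?_⟩, fun c v => ?_⟩, ?_⟩, key⟩
  · have hA : Tendsto (fun t : ℝ => (t, x + t • v, w)) (𝓝[≠] 0) (𝓝[≠] 0 ×ˢ 𝓝 (x, w)) :=
      tendsto_id.prodMk ((tendsto_add_smul x v).prodMk_nhds tendsto_const_nhds)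
    have h1 := (hdf x hx v).add ((key w).comp hA)
    refine (hdf x hx (v + w)).unique (Tendsto.congr (fun t => ?_) h1)
    simp only [Function.comp, ← smul_add]
    congr 1
    rw [smul_add, ← add_assoc]
    abel
  · exact (hdf x hx (c • v)).unique ((hdf x hx v).smul_right c)
  · have : Continuous fun v : E => ((x, v) : E × E) := by fun_prop
    exact hc.comp_continuous this fun v => ⟨hx, trivial⟩

/-- The derivative of a local diffeomorphism that maps a closed subspace into another one
infinitesimally is an injective continuous linear map between these subspaces. -/
theorem IsSmoothAt.exists_injective_restrict [IsTopologicalAddGroup E] [ContinuousSMul ℝ E]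
    [LocallyConvexSpace ℝ E] [T2Space E]
    [IsTopologicalAddGroup F] [ContinuousSMul ℝ F] [LocallyConvexSpace ℝ F] [T2Space F]
    {f : E → F} {g : F → E} {x : E} (hf : IsSmoothAt f x) (hg : IsSmoothAt g (f x))
    (hgf : ∀ᶠ y in 𝓝 x, g (f y) = y) {A : Submodule ℝ E} {B : Submodule ℝ F}
    (hB : IsClosed (B : Set F))
    (hAB : ∀ w ∈ A, ∀ᶠ t : ℝ in 𝓝[≠] 0, f (x + t • w) - f x ∈ B) :
    ∃ L : A →L[ℝ] B, Function.Injective L ∧ ∃ D : E →L[ℝ] F, HasStrictDirDeriv f D x ∧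
      ∀ w : A, (L w : F) = D w := by
  obtain ⟨D, hD⟩ := hf.exists_hasStrictDirDeriv
  obtain ⟨D', hD'⟩ := hg.exists_hasStrictDirDeriv
  have hDB : ∀ w : A, D w ∈ B := fun w => hB.mem_of_tendsto (hD.hasDirDeriv w)
    ((hAB w w.2).mono fun t ht => B.smul_mem _ ht)
  refine ⟨(D.comp A.subtypeL).codRestrict B hDB, ?_, D, hD, fun w => rfl⟩
  -- The chain rule for `g ∘ f = id` makes `D'` a left inverse of `D`.
  have hinv : ∀ w, D' (D w) = w := by
    intro w
    have h1 : HasDirDeriv (g ∘ f) (D' (D w)) x w := (hD.hasDirDeriv w).comp_of_strict (hD' _)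
    exact (h1.congr (g := ContinuousLinearMap.id ℝ E) hgf).unique
      ((ContinuousLinearMap.id ℝ E).hasDirDeriv x w)
  intro v w hvw
  have : D v = D w := congrArg Subtype.val hvw
  exact Subtype.ext (by rw [← hinv v, this, hinv w])

end SmoothAt

/-- In finite dimensions, strict directional derivatives give a strict Fréchet derivative. -/
theorem HasStrictDirDeriv.hasStrictFDerivAt {E F : Type*} [NormedAddCommGroup E] [NormedSpace ℝ E]
    [FiniteDimensional ℝ E] [NormedAddCommGroup F] [NormedSpace ℝ F] {f : E → F} {D : E →L[ℝ] F}
    {x : E} (h : HasStrictDirDeriv f D x) : HasStrictFDerivAt f D x := by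
  -- Compactness of the unit sphere makes the convergence uniform in the direction; an arbitrary
  -- increment is then its norm times a unit vector.
  have hK : IsCompact (Metric.sphere (0 : E) 1) := isCompact_sphere _ _
  rw [hasStrictFDerivAt_iff_isLittleO, Asymptotics.isLittleO_iff]
  intro ε hε
  have key : ∀ v ∈ Metric.sphere (0 : E) 1, ∀ᶠ z : (ℝ × E) × E in 𝓝 ((0, x), v),
      z.1.1 ≠ 0 → ‖z.1.1⁻¹ • (f (z.1.2 + z.1.1 • z.2) - f z.1.2) - D z.2‖ < ε := by
    intro v _
    have h1 : Tendsto (fun p : ℝ × E × E => p.1⁻¹ • (f (p.2.1 + p.1 • p.2.2) - f p.2.1) - D p.2.2)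
        (𝓝[≠] 0 ×ˢ 𝓝 (x, v)) (𝓝 (D v - D v)) := by
      refine (h v).sub ?_
      have : Continuous fun q : E × E => D q.2 := by fun_prop
      exact (this.tendsto (x, v)).comp tendsto_snd
    rw [sub_self] at h1
    have h2 := h1.eventually (Metric.ball_mem_nhds (0 : F) hε)
    rw [← nhdsWithin_univ (x, v), ← nhdsWithin_prod_eq, eventually_nhdsWithin_iff] at h2
    have h3 : Tendsto (fun z : (ℝ × E) × E => (z.1.1, z.1.2, z.2)) (𝓝 ((0, x), v))
        (𝓝 (0, x, v)) := by
      have : Continuous fun z : (ℝ × E) × E => (z.1.1, z.1.2, z.2) := by fun_prop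
      exact this.tendsto ((0, x), v)
    filter_upwards [h3.eventually h2] with z hz hz0
    exact mem_ball_zero_iff.1 (hz ⟨hz0, trivial⟩)
  have key2 := hK.eventually_forall_of_forall_eventually
    (P := fun (q : ℝ × E) (w : E) => q.1 ≠ 0 → ‖q.1⁻¹ • (f (q.2 + q.1 • w) - f q.2) - D w‖ < ε) key
  have h4 : Tendsto (fun p : E × E => (‖p.1 - p.2‖, p.2)) (𝓝 (x, x)) (𝓝 (0, x)) := by
    have : Continuous fun p : E × E => (‖p.1 - p.2‖, p.2) := by fun_prop
    simpa using this.tendsto (x, x)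
  filter_upwards [h4.eventually key2] with p hp
  rcases eq_or_ne p.1 p.2 with hpp | hpp
  · simp [hpp]
  have hn : ‖p.1 - p.2‖ ≠ 0 := norm_ne_zero_iff.2 (sub_ne_zero.2 hpp)
  have h5 := hp (‖p.1 - p.2‖⁻¹ • (p.1 - p.2))
    (by rw [mem_sphere_zero_iff_norm, norm_smul, norm_inv, norm_norm, inv_mul_cancel₀ hn]) hn
  simp only [smul_smul, mul_inv_cancel₀ hn, one_smul, add_sub_cancel, map_smul, ← smul_sub] at h5
  rw [norm_smul, norm_inv, norm_norm, inv_mul_lt_iff₀ (lt_of_le_of_ne (norm_nonneg _) hn.symm),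
    mul_comm] at h5
  exact h5.le

/-- A self-map of a finite-dimensional space that is smooth with injective derivative at `x` is
open at `x`. -/
theorem IsSmoothAt.map_nhds_eq {E : Type*} [AddCommGroup E] [Module ℝ E] [TopologicalSpace E]
    [IsTopologicalAddGroup E] [ContinuousSMul ℝ E] [LocallyConvexSpace ℝ E] [T2Space E]
    [FiniteDimensional ℝ E] {f : E → E} {x : E} (hf : IsSmoothAt f x) {L : E →L[ℝ] E}
    (hL : ∀ v, HasDirDeriv f (L v) x v) (hinj : Function.Injective L) : map f (𝓝 x) = 𝓝 (f x) := by
  -- Conjugating with `e` moves the problem to a normed space, where the strict Fréchet derivative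
  -- applies; by dimension, an injective derivative is surjective.
  let e : E ≃L[ℝ] EuclideanSpace ℝ (Fin (Module.finrank ℝ E)) :=
    ContinuousLinearEquiv.ofFinrankEq (by simp)
  have hh : IsSmoothAt (e ∘ (f ∘ e.symm)) (e x) := by
    have h1 : IsSmoothAt (f ∘ e.symm) (e x) := by
      refine IsSmoothAt.comp (by simpa using hf) ?_
      exact e.symm.toContinuousLinearMap.isSmoothAt _
    exact IsSmoothAt.comp (e.toContinuousLinearMap.isSmoothAt _) h1
  obtain ⟨D, hD⟩ := hh.exists_hasStrictDirDeriv
  have hDL : ∀ w, D w = e (L (e.symm w)) := by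
    intro w
    refine (hD.hasDirDeriv w).unique ?_
    have := (e.continuous.tendsto _).comp (hL (e.symm w))
    refine this.congr fun t => ?_
    simp
  have hDinj : Function.Injective D := by
    intro v w hvw
    rw [hDL, hDL] at hvw
    exact e.symm.injective (hinj (e.injective hvw))
  have hsurj : D.range = ⊤ :=
    LinearMap.range_eq_top (f := D.toLinearMap) |>.2
      ((LinearMap.injective_iff_surjective (f := D.toLinearMap)).1 hDinj)
  have h2 := hD.hasStrictFDerivAt.map_nhds_eq_of_surj hsurj
  have h3 : (f : E → E) = e.symm ∘ (e ∘ (f ∘ e.symm)) ∘ e := by ext; simp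
  have h4 : map e (𝓝 x) = 𝓝 (e x) := e.toHomeomorph.map_nhds_eq x
  have h5 : map e.symm (𝓝 (e (f x))) = 𝓝 (f x) := by
    simpa using e.symm.toHomeomorph.map_nhds_eq (e (f x))
  conv_lhs => rw [h3]
  rw [← Filter.map_map, ← Filter.map_map, h4, h2]
  simpa using h5

/-! ### Charts, maximal atlas and submanifolds. -/

section Charts

variable {M : Type*} [TopologicalSpace M]

theorem LCChart.SmoothTransition.isSmoothAt {c c' : LCChart.{uE} M} (h : c.SmoothTransition c')
    {x : M} (hx : x ∈ c.toHomeo.source) (hx' : x ∈ c'.toHomeo.source) :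
    IsSmoothAt (c'.toHomeo ∘ c.toHomeo.symm) (c.toHomeo x) := by
  refine IsSmoothOn.isSmoothAt h
    (c.toHomeo.symm.isOpen_inter_preimage c'.toHomeo.open_source) ⟨c.toHomeo.map_source hx, ?_⟩
  simpa only [mem_preimage, c.toHomeo.left_inv hx] using hx'

theorem LCChart.smoothTransition_of_isSmoothAt {c c' : LCChart.{uE} M}
    (h : ∀ x ∈ c.toHomeo.source, x ∈ c'.toHomeo.source →
      IsSmoothAt (c'.toHomeo ∘ c.toHomeo.symm) (c.toHomeo x)) : c.SmoothTransition c' := by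
  refine isSmoothOn_of_forall_isSmoothAt ?_
  rintro y ⟨hy, hy'⟩
  have := h _ (c.toHomeo.map_target hy) hy'
  rwa [c.toHomeo.right_inv hy] at this

/-- Smoothness of a composition through a manifold, tested in a chart. -/
theorem IsSmoothAt.comp_of_chart {E F : Type*} [AddCommGroup E] [Module ℝ E] [TopologicalSpace E]
    [IsTopologicalAddGroup E] [ContinuousSMul ℝ E]
    [AddCommGroup F] [Module ℝ F] [TopologicalSpace F]
    [IsTopologicalAddGroup F] [ContinuousSMul ℝ F] [LocallyConvexSpace ℝ F]
    (d : LCChart.{uE} M) {p : E → M} {q : M → F} {x : E} (hp : ContinuousAt p x)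
    (hx : p x ∈ d.toHomeo.source) (h1 : IsSmoothAt (d.toHomeo ∘ p) x)
    (h2 : IsSmoothAt (q ∘ d.toHomeo.symm) (d.toHomeo (p x))) : IsSmoothAt (q ∘ p) x := by
  refine (IsSmoothAt.comp (f := d.toHomeo ∘ p) h2 h1).congr ?_
  filter_upwards [hp.preimage_mem_nhds (d.toHomeo.open_source.mem_nhds hx)] with y hy
  simp only [Function.comp, d.toHomeo.left_inv hy]

variable [LCChartedSpace.{uE} M]

/-- Compatibility is only assumed with the atlas, so the transition is factored through the
preferred chart at the point. -/
theorem smoothTransition_of_mem_maxAtlas {c c' : LCChart.{uE} M} (hc : c ∈ maxAtlas.{uE} M)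
    (hc' : c' ∈ maxAtlas.{uE} M) : c.SmoothTransition c' := by
  refine LCChart.smoothTransition_of_isSmoothAt fun x hx hx' => ?_
  have hd := LCChartedSpace.chart_mem_atlas.{uE} x
  have hxd := LCChartedSpace.mem_chart_source.{uE} x
  have e : c.toHomeo.symm (c.toHomeo x) = x := c.toHomeo.left_inv hx
  refine IsSmoothAt.comp_of_chart (LCChartedSpace.chartAt x)
    (c.toHomeo.continuousAt_symm (c.toHomeo.map_source hx)) (by rwa [e])
    ((hc _ hd).1.isSmoothAt hx hxd) ?_
  rw [e]
  exact (hc' _ hd).2.isSmoothAt hxd hx'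

theorem MSmoothOn.isSmoothAt {N : Type*} [TopologicalSpace N] [LCChartedSpace.{uE} N] {f : M → N}
    {s : Set M} (h : MSmoothOn.{uE} f s) (hs : IsOpen s) {c : LCChart.{uE} M} {d : LCChart.{uE} N}
    (hc : c ∈ LCChartedSpace.atlas (M := M)) (hd : d ∈ LCChartedSpace.atlas (M := N)) {x : M}
    (hx : x ∈ s) (hxc : x ∈ c.toHomeo.source) (hxd : f x ∈ d.toHomeo.source) :
    IsSmoothAt (d.toHomeo ∘ f ∘ c.toHomeo.symm) (c.toHomeo x) := by
  refine IsSmoothOn.isSmoothAt (h.2 c hc d hd) ?_ ⟨c.toHomeo.map_source hxc, ?_⟩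
  · exact c.toHomeo.symm.isOpen_inter_preimage (h.1.isOpen_inter_preimage hs d.toHomeo.open_source)
  · rw [mem_preimage, c.toHomeo.left_inv hxc]
    exact ⟨hx, hxd⟩

theorem LCChart.IsAdapted.apply_mem_iff {φ : LCChart.{uE} M} {F : Submodule ℝ φ.model} {S : Set M}
    (h : φ.IsAdapted F S) {x : M} (hx : x ∈ φ.toHomeo.source) : φ.toHomeo x ∈ F ↔ x ∈ S := by
  refine ⟨fun hF => ?_, fun hS => h.apply_mem ⟨x, hS⟩ hx⟩
  simpa [φ.toHomeo.left_inv hx] using h.symm_mem ⟨_, hF⟩ (φ.toHomeo.map_source hx)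

/-- The induced charts of a submanifold are smoothly compatible. -/
theorem IsSubmanifold.isLCManifold_charted (hM : IsLCManifold.{uE} M) {S : Set M}
    (hS : IsSubmanifold.{uE} S) : @IsLCManifold.{uE} S _ hS.charted := by
  have := hM.t2
  let _ := hS.charted
  refine ⟨inferInstance, ?_⟩
  rintro _ ⟨φ, hφ, F, h, s, rfl⟩ _ ⟨φ', hφ', F', h', s', rfl⟩
  refine LCChart.smoothTransition_of_isSmoothAt fun x hx hx' => ?_
  have hx1 : (x : M) ∈ φ.toHomeo.source := hx
  have hx1' : (x : M) ∈ φ'.toHomeo.source := hx'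
  have hval : ∀ y : S, (y : M) ∈ φ.toHomeo.source →
      ((φ.restrictHomeo F h s y : F) : φ.model) = φ.toHomeo y := fun y hy =>
    congrArg Subtype.val (dif_pos (h.apply_mem y hy))
  refine IsSmoothAt.codRestrict h'.1 ?_
  have h1 := (smoothTransition_of_mem_maxAtlas hφ hφ').isSmoothAt hx1 hx1'
  have h2 : IsSmoothAt ((φ'.toHomeo ∘ φ.toHomeo.symm) ∘ F.subtypeL)
      ((φ.restrict F h s).toHomeo x) := by
    refine IsSmoothAt.comp ?_ (F.subtypeL.isSmoothAt _)
    have e : F.subtypeL ((φ.restrict F h s).toHomeo x) = φ.toHomeo x := hval x hx1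
    rwa [e]
  refine h2.congr ?_
  have hopen : IsOpen ((φ.restrict F h s).toHomeo.target ∩
      (φ.restrict F h s).toHomeo.symm ⁻¹' (φ'.restrict F' h' s').toHomeo.source) :=
    (φ.restrict F h s).toHomeo.symm.isOpen_inter_preimage
      (φ'.restrict F' h' s').toHomeo.open_source
  filter_upwards [hopen.mem_nhds ⟨(φ.restrict F h s).toHomeo.map_source hx, by
    rw [mem_preimage, (φ.restrict F h s).toHomeo.left_inv hx]; exact hx'⟩] with y hy
  have e1 : (((φ.restrict F h s).toHomeo.symm y : S) : M) = φ.toHomeo.symm (y : φ.model) :=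
    congrArg Subtype.val (dif_pos (h.symm_mem y hy.1))
  have e2 : ((φ'.restrictHomeo F' h' s' ((φ.restrict F h s).toHomeo.symm y) : F') : φ'.model)
      = φ'.toHomeo ((φ.restrict F h s).toHomeo.symm y : S) :=
    congrArg Subtype.val (dif_pos (h'.apply_mem _ hy.2))
  exact (congrArg φ'.toHomeo e1.symm).trans e2.symm

theorem IsSubmanifold.isLocallyClosed {S : Set M} (hS : IsSubmanifold.{uE} S) :
    IsLocallyClosed S := by
  refine ((isLocallyClosed_tfae S).out 0 3).2 fun x hx => ?_
  obtain ⟨φ, -, hxφ, F, h⟩ := hS x hx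
  refine ⟨φ.toHomeo.source, hxφ, φ.toHomeo.open_source, ?_⟩
  rintro y ⟨hy, hyS⟩
  by_contra hnot
  have ho : IsOpen (φ.toHomeo.source ∩ φ.toHomeo ⁻¹' (F : Set φ.model)ᶜ) :=
    φ.toHomeo.isOpen_inter_preimage h.1.isOpen_compl
  obtain ⟨z, ⟨hz, hzF⟩, hzS⟩ :=
    mem_closure_iff.1 hyS _ ho ⟨hy, fun hyF => hnot ((h.apply_mem_iff hy).1 hyF)⟩
  exact hzF ((h.apply_mem_iff hz).2 hzS)

end Charts

/-! ### Translations and conjugation; a topological surjectivity criterion. -/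

section LieGroup

variable {G : Type*} [Group G] [TopologicalSpace G] [LCChartedSpace.{uE} G]

theorem IsLCLieGroup.isTopologicalGroup (hG : IsLCLieGroup.{uE} G) : IsTopologicalGroup G where
  continuous_mul := continuousOn_univ.1 hG.smooth_mul.1
  continuous_inv := continuousOn_univ.1 hG.smooth_inv.1

theorem IsLCLieGroup.isSmoothAt_mul_left (hG : IsLCLieGroup.{uE} G) (a : G) {d d' : LCChart.{uE} G}
    (hd : d ∈ LCChartedSpace.atlas (M := G)) (hd' : d' ∈ LCChartedSpace.atlas (M := G)) {g : G}
    (hg : g ∈ d.toHomeo.source) (hg' : a * g ∈ d'.toHomeo.source) :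
    IsSmoothAt (d'.toHomeo ∘ (fun x => a * x) ∘ d.toHomeo.symm) (d.toHomeo g) := by
  have ha := LCChartedSpace.mem_chart_source.{uE} a
  have h := hG.smooth_mul.isSmoothAt isOpen_univ (c := ⟨LCSpace.prod _ d.model,
      (LCChartedSpace.chartAt a).toHomeo.prod d.toHomeo⟩)
    ⟨_, LCChartedSpace.chart_mem_atlas a, d, hd, rfl⟩ hd' (x := (a, g)) trivial ⟨ha, hg⟩ hg'
  refine (IsSmoothAt.comp (f := fun y : d.model => ((LCChartedSpace.chartAt a).toHomeo a, y)) h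
    ((isSmoothAt_const _ (d.toHomeo g)).prodMk (isSmoothAt_id _))).congr (Eventually.of_forall fun y => ?_)
  simp [(LCChartedSpace.chartAt a).toHomeo.left_inv ha]

theorem IsLCLieGroup.isSmoothAt_mul_right (hG : IsLCLieGroup.{uE} G) (a : G)
    {d d' : LCChart.{uE} G}
    (hd : d ∈ LCChartedSpace.atlas (M := G)) (hd' : d' ∈ LCChartedSpace.atlas (M := G)) {g : G}
    (hg : g ∈ d.toHomeo.source) (hg' : g * a ∈ d'.toHomeo.source) :
    IsSmoothAt (d'.toHomeo ∘ (fun x => x * a) ∘ d.toHomeo.symm) (d.toHomeo g) := by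
  have ha := LCChartedSpace.mem_chart_source.{uE} a
  have h := hG.smooth_mul.isSmoothAt isOpen_univ (c := ⟨LCSpace.prod d.model _,
      d.toHomeo.prod (LCChartedSpace.chartAt a).toHomeo⟩)
    ⟨d, hd, _, LCChartedSpace.chart_mem_atlas a, rfl⟩ hd' (x := (g, a)) trivial ⟨hg, ha⟩ hg'
  refine (IsSmoothAt.comp (f := fun y : d.model => (y, (LCChartedSpace.chartAt a).toHomeo a)) h
    ((isSmoothAt_id (d.toHomeo g)).prodMk (isSmoothAt_const _ _))).congr (Eventually.of_forall fun y => ?_)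
  simp [(LCChartedSpace.chartAt a).toHomeo.left_inv ha]

/-- Conjugation is smooth at the identity, in any chart. -/
theorem IsLCLieGroup.isSmoothAt_conj (hG : IsLCLieGroup.{uE} G) (a : G) {φ : LCChart.{uE} G}
    (hφ : φ ∈ maxAtlas.{uE} G) (h1 : (1 : G) ∈ φ.toHomeo.source) :
    IsSmoothAt (φ.toHomeo ∘ (fun x => a * x * a⁻¹) ∘ φ.toHomeo.symm) (φ.toHomeo 1) := by
  have := hG.isTopologicalGroup
  have hs := fun x : G => LCChartedSpace.mem_chart_source.{uE} x
  have ht := fun x : G => LCChartedSpace.chart_mem_atlas.{uE} x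
  have e1 : φ.toHomeo.symm (φ.toHomeo 1) = 1 := φ.toHomeo.left_inv h1
  have e2 := (LCChartedSpace.chartAt.{uE} (1 : G)).toHomeo.left_inv (hs 1)
  have e3 := (LCChartedSpace.chartAt.{uE} (a * 1 : G)).toHomeo.left_inv (hs (a * 1))
  have e4 : a * 1 * a⁻¹ = 1 := by group
  refine IsSmoothAt.comp_of_chart (q := φ.toHomeo ∘ fun x => a * x * a⁻¹)
    (LCChartedSpace.chartAt.{uE} (1 : G))
    (φ.toHomeo.continuousAt_symm (φ.toHomeo.map_source h1)) (by rw [e1]; exact hs 1)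
    ((hφ _ (ht 1)).1.isSmoothAt h1 (hs 1)) ?_
  rw [e1]
  -- The conjugation passes through charts at `1`, `a * 1` and `1`. The middle one is taken at `a *
  -- 1` so that it contains the value of the left translation as written.
  refine IsSmoothAt.comp_of_chart (q := φ.toHomeo ∘ fun x => x * a⁻¹)
    (p := (fun x => a * x) ∘ (LCChartedSpace.chartAt.{uE} (1 : G)).toHomeo.symm)
    (LCChartedSpace.chartAt.{uE} (a * 1 : G)) ?_ ?_ ?_ ?_
  · exact (continuous_const_mul a).continuousAt.comp (OpenPartialHomeomorph.continuousAt_symm _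
      (OpenPartialHomeomorph.map_source _ (hs 1)))
  · simp only [Function.comp, e2]; exact hs _
  · exact hG.isSmoothAt_mul_left a (ht 1) (ht _) (hs 1) (hs _)
  simp only [Function.comp, e2]
  refine IsSmoothAt.comp_of_chart (q := φ.toHomeo)
    (p := (fun x => x * a⁻¹) ∘ (LCChartedSpace.chartAt.{uE} (a * 1 : G)).toHomeo.symm)
    (LCChartedSpace.chartAt.{uE} (1 : G)) ?_ ?_ ?_ ?_
  · exact (continuous_mul_const a⁻¹).continuousAt.comp (OpenPartialHomeomorph.continuousAt_symm _
      (OpenPartialHomeomorph.map_source _ (hs _)))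
  · simp only [Function.comp, e3, e4]; exact hs _
  · exact hG.isSmoothAt_mul_right a⁻¹ (ht _) (ht _) (hs _) (by rw [e4]; exact hs _)
  · simp only [Function.comp, e3, e4]
    exact (hφ _ (ht 1)).2.isSmoothAt (hs 1) h1

/-- An injective open continuous self-map of a space with finitely many connected components and
closed range is surjective. -/
theorem Function.Injective.surjective_of_finite_connectedComponents {X : Type*} [TopologicalSpace X]
    [Finite (ConnectedComponents X)] {f : X → X} (hinj : Function.Injective f) (hf : Continuous f)
    (ho : IsOpenMap f) (hc : IsClosed (range f)) : Function.Surjective f := by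
  have hclopen : IsClopen (range f) := ⟨hc, ho.isOpen_range⟩
  have hinj' : Function.Injective hf.connectedComponentsMap := by
    intro x y hxy
    obtain ⟨x, rfl⟩ := ConnectedComponents.surjective_coe x
    obtain ⟨y, rfl⟩ := ConnectedComponents.surjective_coe y
    have h1 : f y ∈ connectedComponent (f x) := by
      have : ((f x : X) : ConnectedComponents X) = f y := hxy
      rw [ConnectedComponents.coe_eq_coe.1 this]
      exact mem_connectedComponent
    -- The clopen range contains the whole component of `f x`, so the preimage of this component
    -- under the injective open map is connected.
    have h2 : IsPreconnected (f ⁻¹' connectedComponent (f x)) :=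
      isPreconnected_connectedComponent.preimage_of_isOpenMap hinj ho
        (hclopen.connectedComponent_subset ⟨x, rfl⟩)
    rw [ConnectedComponents.coe_eq_coe']
    exact connectedComponent_eq (h2.subset_connectedComponent (mem_connectedComponent) h1) ▸
      mem_connectedComponent
  intro y
  -- An injection of the finite set of components is onto, so the component of `y` meets the range,
  -- which is clopen and hence contains it.
  obtain ⟨x, hx⟩ := Finite.surjective_of_injective hinj' y
  obtain ⟨x, rfl⟩ := ConnectedComponents.surjective_coe x
  have : ((f x : X) : ConnectedComponents X) = y := hx
  have h1 := hclopen.connectedComponent_subset ⟨x, rfl⟩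
  exact h1 (ConnectedComponents.coe_eq_coe'.1 this.symm)

end LieGroup

/-! ### Compact Lie subgroups and conjugation. -/

section CompactSubgroup

variable {G : Type*} [Group G] [TopologicalSpace G]

/-- A topological group with one chart at the identity is a topological manifold, by translation. -/
@[reducible] noncomputable def ChartedSpace.ofChartAtOne {X : Type*} [TopologicalSpace X] [IsTopologicalGroup G]
    (ρ : OpenPartialHomeomorph G X) (h : (1 : G) ∈ ρ.source) : ChartedSpace X G where
  atlas := range fun k : G => (Homeomorph.mulLeft k⁻¹).toOpenPartialHomeomorph.trans ρ
  chartAt k := (Homeomorph.mulLeft k⁻¹).toOpenPartialHomeomorph.trans ρ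
  mem_chart_source k := by simpa using h
  chart_mem_atlas k := ⟨k, rfl⟩

/-- A locally compact topological group, modelled at the identity on a Hausdorff topological vector
space, is modelled on a finite-dimensional one. -/
theorem finiteDimensional_of_openPartialHomeomorph {K F : Type*} [TopologicalSpace K]
    [LocallyCompactSpace K] [AddCommGroup F] [Module ℝ F] [TopologicalSpace F]
    [IsTopologicalAddGroup F] [ContinuousSMul ℝ F] [T2Space F] (ρ : OpenPartialHomeomorph K F)
    {k : K} (hk : k ∈ ρ.source) : FiniteDimensional ℝ F := by
  obtain ⟨N, hN, hNs, hNc⟩ := local_compact_nhds (ρ.open_source.mem_nhds hk)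
  have h1 : IsCompact (ρ '' N) := hNc.image_of_continuousOn (ρ.continuousOn.mono hNs)
  have h2 : ρ '' N ∈ 𝓝 (ρ k) := ρ.image_mem_nhds hk hN
  have := h1.locallyCompactSpace_of_mem_nhds_of_addGroup h2
  exact FiniteDimensional.of_locallyCompactSpace ℝ

variable [LCChartedSpace.{uE} G]

/-- A compact Lie subgroup is not conjugate to any of its proper subgroups. -/
theorem Subgroup.exists_conj_eq_of_isCompact (hG : IsLCLieGroup.{uE} G) {K : Subgroup G}
    (hK : IsCompact (K : Set G)) (hsub : IsSubmanifold.{uE} (K : Set G)) {a : G}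
    (ha : ∀ k ∈ K, a * k * a⁻¹ ∈ K) {k : G} (hk : k ∈ K) : ∃ k' ∈ K, a * k' * a⁻¹ = k := by
  have := hG.isTopologicalGroup
  have := hG.manifold.t2
  have : CompactSpace K := isCompact_iff_compactSpace.1 hK
  obtain ⟨φ, hφ, h1, F, hF⟩ := hsub 1 K.one_mem
  let ρ : OpenPartialHomeomorph K F := φ.restrictHomeo F hF ⟨1, K.one_mem⟩
  have hρ1 : (1 : K) ∈ ρ.source := h1
  have hfin : FiniteDimensional ℝ F := finiteDimensional_of_openPartialHomeomorph ρ hρ1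
  -- Local connectedness passes from the model to `K` and, with compactness, makes the set of
  -- components finite.
  have hFc : LocallyConnectedSpace F :=
    (ContinuousLinearEquiv.ofFinrankEq (𝕜 := ℝ) (E := F)
      (F := EuclideanSpace ℝ (Fin (Module.finrank ℝ F)))
      (by simp)).toHomeomorph.isOpenEmbedding.locallyConnectedSpace
  let _ := ChartedSpace.ofChartAtOne ρ hρ1
  have : LocallyConnectedSpace K := ChartedSpace.locallyConnectedSpace F K
  let c : K →* K :=
    { toFun := fun k => ⟨a * k * a⁻¹, ha k k.2⟩
      map_one' := Subtype.ext (by simp)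
      map_mul' := fun x y => Subtype.ext (by simp) }
  have hc : Continuous c := Continuous.subtype_mk (by fun_prop) _
  have hinj : Function.Injective c := fun x y hxy => Subtype.ext (by
    simpa [c] using congrArg Subtype.val hxy)
  have hρ : ∀ y : K, (y : G) ∈ φ.toHomeo.source → ((ρ y : F) : φ.model) = φ.toHomeo y :=
    fun y hy => congrArg Subtype.val (dif_pos (hF.apply_mem y hy))
  have hρs : ∀ x ∈ ρ.target, ((ρ.symm x : K) : G) = φ.toHomeo.symm (x : φ.model) := fun x hx =>
    congrArg Subtype.val (dif_pos (hF.symm_mem x hx))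
  have e1 : φ.toHomeo.symm (φ.toHomeo 1) = 1 := φ.toHomeo.left_inv h1
  have conj1 : ∀ b : G, (φ.toHomeo ∘ (fun x => b * x * b⁻¹) ∘ φ.toHomeo.symm) (φ.toHomeo 1)
    = φ.toHomeo 1 := by simp [e1]
  have hnear : ∀ b : G, ∀ᶠ y in 𝓝 (φ.toHomeo 1), y ∈ φ.toHomeo.target ∧
      b * φ.toHomeo.symm y * b⁻¹ ∈ φ.toHomeo.source := by
    intro b
    refine Eventually.and (φ.toHomeo.open_target.mem_nhds (φ.toHomeo.map_source h1)) ?_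
    have : ContinuousAt (fun y => b * φ.toHomeo.symm y * b⁻¹) (φ.toHomeo 1) :=
      (continuousAt_const.mul
        (φ.toHomeo.continuousAt_symm (φ.toHomeo.map_source h1))).mul continuousAt_const
    refine this.preimage_mem_nhds (φ.toHomeo.open_source.mem_nhds ?_)
    simpa [e1] using h1
  have hsm := fun b : G => hG.isSmoothAt_conj b hφ h1
  -- `L` is the derivative at `1` of conjugation by `a`, restricted to `F`. It takes values in `F`
  -- because conjugation preserves `K`, and it is injective because conjugation by `a⁻¹` is a smooth
  -- inverse.
  obtain ⟨L, hLinj, D, hD, hLD⟩ := (hsm a).exists_injective_restrict (A := F) (B := F)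
    (g := φ.toHomeo ∘ (fun x => a⁻¹ * x * a⁻¹⁻¹) ∘ φ.toHomeo.symm)
    (by rw [conj1]; exact hsm a⁻¹) (by
      filter_upwards [hnear a] with y hy
      simp only [Function.comp, φ.toHomeo.left_inv hy.2]
      have : a⁻¹ * (a * φ.toHomeo.symm y * a⁻¹) * a⁻¹⁻¹ = φ.toHomeo.symm y := by group
      rw [this, φ.toHomeo.right_inv hy.1]) hF.1 (by
      intro w hw
      filter_upwards [(tendsto_add_smul (φ.toHomeo 1) w).eventually (hnear a)] with t ht
      have hm : φ.toHomeo 1 ∈ F := hF.apply_mem ⟨1, K.one_mem⟩ h1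
      rw [conj1]
      refine F.sub_mem ?_ hm
      have hK' := hF.symm_mem ⟨_, F.add_mem hm (F.smul_mem t hw)⟩ ht.1
      exact hF.apply_mem ⟨_, ha _ hK'⟩ ht.2)
  let p : F := ρ 1
  have hp : (p : φ.model) = φ.toHomeo 1 := hρ 1 h1
  have hps : ρ.symm p = 1 := ρ.left_inv hρ1
  have hpt : p ∈ ρ.target := ρ.map_source hρ1
  have hev : (φ.toHomeo ∘ (fun x => a * x * a⁻¹) ∘ φ.toHomeo.symm) ∘ F.subtypeL =ᶠ[𝓝 p]
      fun y => ((ρ ∘ c ∘ ρ.symm) y : φ.model) := by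
    have hcont : ContinuousAt F.subtypeL p := F.subtypeL.continuous.continuousAt
    have hn := hnear a
    rw [← hp] at hn
    filter_upwards [hcont.eventually hn, ρ.open_target.mem_nhds hpt] with y hy hyt
    have hy2 : ((c (ρ.symm y) : K) : G) ∈ φ.toHomeo.source := by
      change a * ((ρ.symm y : K) : G) * a⁻¹ ∈ _
      rw [hρs y hyt]; exact hy.2
    simp only [Function.comp]
    rw [hρ _ hy2]
    change _ = φ.toHomeo (a * ((ρ.symm y : K) : G) * a⁻¹)
    rw [hρs y hyt]; rfl
  have hsmooth : IsSmoothAt (ρ ∘ c ∘ ρ.symm) p := by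
    refine IsSmoothAt.codRestrict hF.1 (IsSmoothAt.congr ?_ hev)
    refine IsSmoothAt.comp ?_ (F.subtypeL.isSmoothAt _)
    have : F.subtypeL p = φ.toHomeo 1 := hp
    rw [this]; exact hsm a
  have hder : ∀ v, HasDirDeriv (ρ ∘ c ∘ ρ.symm) (L v) p v := by
    intro v
    have h2 : HasDirDeriv ((φ.toHomeo ∘ (fun x => a * x * a⁻¹) ∘ φ.toHomeo.symm) ∘ F.subtypeL)
        (D v) p v := by
      have := hD.hasDirDeriv v
      rw [← hp] at this
      exact this
    have h3 := h2.congr hev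
    rw [← hLD] at h3
    exact tendsto_subtype_rng.2 h3
  have hmap := hsmooth.map_nhds_eq hder hLinj
  -- For a group homomorphism, openness at the identity is enough.
  have hopen : IsOpenMap c := by
    rw [IsTopologicalGroup.isOpenMap_iff_nhds_one]
    have h4 : c =ᶠ[𝓝 1] ρ.symm ∘ (ρ ∘ c ∘ ρ.symm) ∘ ρ := by
      have h5 : ∀ᶠ x in 𝓝 (1 : K), c x ∈ ρ.source :=
        hc.continuousAt.preimage_mem_nhds (ρ.open_source.mem_nhds (by rwa [map_one]))
      filter_upwards [h5, ρ.open_source.mem_nhds hρ1] with x hx hx'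
      simp only [Function.comp, ρ.left_inv hx', ρ.left_inv hx]
    have h6 : (ρ ∘ c ∘ ρ.symm) p = p := by simp [hps, p]
    rw [Filter.map_congr h4, ← Filter.map_map, ← Filter.map_map, ρ.map_nhds_eq hρ1, hmap, h6,
      ρ.symm_map_nhds_eq hρ1]
  obtain ⟨k', hk'⟩ := hinj.surjective_of_finite_connectedComponents hc hopen
    (isCompact_range hc).isClosed ⟨k, hk⟩
  exact ⟨k', k'.2, congrArg Subtype.val hk'⟩

end CompactSubgroup

/-! ### Transport of charts along diffeomorphisms. -/

section Diffeo

variable {P M : Type*} [TopologicalSpace P] [TopologicalSpace M] [LCChartedSpace.{uE} P]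
  [LCChartedSpace.{uE} M]

/-- A diffeomorphism between open sets as an open partial homeomorphism. -/
theorem IsDiffeoOn.exists_openPartialHomeomorph {f : P → M} {s : Set P}
    (h : IsDiffeoOn.{uE} f s) : ∃ e : OpenPartialHomeomorph P M, e.source = s ∧ ⇑e = f ∧
      e.target = f '' s ∧ MSmoothOn.{uE} e e.source ∧ MSmoothOn.{uE} e.symm e.target := by
  obtain ⟨g, hg, hgs⟩ := h.smooth_inverse
  exact ⟨{  toFun := f
            invFun := g
            source := s
            target := f '' s
            map_source' := fun x hx => mem_image_of_mem f hx
            map_target' := by rintro _ ⟨x, hx, rfl⟩; rwa [hg hx]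
            left_inv' := fun x hx => hg hx
            right_inv' := by rintro _ ⟨x, hx, rfl⟩; rw [hg hx]
            open_source := h.isOpen_source
            open_target := h.isOpen_image
            continuousOn_toFun := h.smooth.1
            continuousOn_invFun := hgs.1 }, rfl, rfl, rfl, h.smooth, hgs⟩

/-- Transporting a chart along a diffeomorphism between open sets. -/
theorem mem_maxAtlas_of_diffeo {e : OpenPartialHomeomorph P M} (he : MSmoothOn.{uE} e e.source)
    (he' : MSmoothOn.{uE} e.symm e.target) {κ : LCChart.{uE} P}
    (hκ : ∀ p ∈ κ.toHomeo.source, ∃ d ∈ LCChartedSpace.atlas (M := P), p ∈ d.toHomeo.source ∧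
      IsSmoothAt (d.toHomeo ∘ κ.toHomeo.symm) (κ.toHomeo p) ∧
      IsSmoothAt (κ.toHomeo ∘ d.toHomeo.symm) (d.toHomeo p)) :
    (⟨κ.model, e.symm.trans κ.toHomeo⟩ : LCChart.{uE} M) ∈ maxAtlas.{uE} M := by
  intro d' hd'
  constructor
  · refine LCChart.smoothTransition_of_isSmoothAt fun v hv hv' => ?_
    have hv1 : v ∈ e.target := hv.1
    have hv2 : e.symm v ∈ κ.toHomeo.source := hv.2
    obtain ⟨d, hd, hpd, h1, -⟩ := hκ _ hv2
    have e1 : κ.toHomeo.symm (κ.toHomeo (e.symm v)) = e.symm v := κ.toHomeo.left_inv hv2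
    refine IsSmoothAt.comp_of_chart (q := d'.toHomeo ∘ e) (p := κ.toHomeo.symm)
      (x := κ.toHomeo (e.symm v)) d
      (κ.toHomeo.continuousAt_symm (κ.toHomeo.map_source hv2)) (by rwa [e1]) h1 ?_
    rw [e1]
    exact he.isSmoothAt e.open_source hd hd' (e.map_target hv1) hpd (by rwa [e.right_inv hv1])
  · refine LCChart.smoothTransition_of_isSmoothAt fun v hv hv' => ?_
    have hv1 : v ∈ e.target := hv'.1
    have hv2 : e.symm v ∈ κ.toHomeo.source := hv'.2
    obtain ⟨d, hd, hpd, -, h2⟩ := hκ _ hv2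
    have e1 : d'.toHomeo.symm (d'.toHomeo v) = v := d'.toHomeo.left_inv hv
    refine IsSmoothAt.comp_of_chart (q := κ.toHomeo) (p := e.symm ∘ d'.toHomeo.symm) d ?_ ?_ ?_ ?_
    · refine ContinuousAt.comp ?_ (d'.toHomeo.continuousAt_symm (d'.toHomeo.map_source hv))
      rw [e1]; exact e.continuousAt_symm hv1
    · simpa only [Function.comp, e1] using hpd
    · exact he'.isSmoothAt e.open_target hd' hd hv1 hv hpd
    · simpa only [Function.comp, e1] using h2

end Diffeo

/-! ### Orbit types and compactness of stabilizers. -/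

section OrbitType

variable {G M : Type*} [Group G] [MulAction G M]

theorem orbitTypeClass_eq_iff {H K : Subgroup G} : orbitTypeClass H = orbitTypeClass K ↔
    ∃ a : G, H.map (MulAut.conj a).toMonoidHom = K :=
  Quotient.eq (r := subgroupConj G)

theorem orbitType_smul (g : G) (m : M) : orbitType G (g • m) = orbitType G m :=
  (orbitTypeClass_eq_iff.2 ⟨g, (MulAction.stabilizer_smul_eq_stabilizer_map_conj g m).symm⟩).symm

/-- The stabilizer is the projection to `G` of the preimage of the single point `(m, m)`. -/
theorem IsProperAction.isCompact_stabilizer [TopologicalSpace G] [TopologicalSpace M]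
    (h : IsProperAction G M) (m : M) : IsCompact (MulAction.stabilizer G m : Set G) := by
  have := (h {(m, m)} isCompact_singleton).image continuous_fst
  convert this
  ext g
  simp [MulAction.mem_stabilizer_iff]

end OrbitType

/-! ### Slices and the slice chart. -/

section Slice

variable {G M : Type*} [Group G] [TopologicalSpace G] [LCChartedSpace.{uE} G]
  [TopologicalSpace M] [LCChartedSpace.{uE} M] [MulAction G M]

theorem IsSlice.stabilizer_le {S : Set M} {m : M} (hS : IsSlice.{uE} G S m) {s : M} (hs : s ∈ S) :
    MulAction.stabilizer G s ≤ MulAction.stabilizer G m := fun g hg =>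
  hS.mem_stabilizer g ⟨s, hs, by rwa [MulAction.mem_stabilizer_iff.1 hg]⟩

/-- A compact principal stabilizer that contains one of its conjugates coincides with it. -/
theorem IsSlice.stabilizer_eq_of_conj_le (hG : IsLCLieGroup.{uE} G) (hproper : IsProperAction G M)
    {S : Set M} {m : M} (hS : IsSlice.{uE} G S m) {K : Subgroup G}
    (hK : orbitTypeClass K = orbitType G m) (hle : K ≤ MulAction.stabilizer G m) :
    K = MulAction.stabilizer G m := by
  obtain ⟨a, ha⟩ := orbitTypeClass_eq_iff.1 hK.symm
  refine le_antisymm hle fun k hk => ?_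
  obtain ⟨k', hk', rfl⟩ := Subgroup.exists_conj_eq_of_isCompact hG
    -- Conjugation by `a` maps the stabilizer onto `K`, which lies inside it; a compact Lie subgroup
    -- mapped into itself is mapped onto itself.
    (hproper.isCompact_stabilizer m) hS.stabilizer_submanifold (a := a)
    (fun k hk => hle (ha ▸ Subgroup.mem_map_of_mem (MulAut.conj a).toMonoidHom hk)) hk
  exact ha ▸ Subgroup.mem_map_of_mem (MulAut.conj a).toMonoidHom hk'

/-- The slice chart: near `m`, the action is described by a chart in which all orbit types are
invariant under translation by a closed subspace, which is the orbit type stratum of `m`. -/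
theorem IsLinearSlice.exists_chart (hG : IsLCLieGroup.{uE} G)
    (hproper : IsProperAction G M) {S : Set M} {m : M} (hS : IsLinearSlice.{uE} G S m) :
    ∃ ψ ∈ maxAtlas.{uE} M, m ∈ ψ.toHomeo.source ∧ ∃ F : Submodule ℝ ψ.model,
      ψ.IsAdapted F (orbitTypeSet M (orbitType G m)) ∧
      (∀ v ∈ ψ.toHomeo.source, orbitType G v ≤ orbitType G m) ∧
      ∀ v ∈ ψ.toHomeo.source, ∀ w ∈ F, ∀ t : ℝ, ψ.toHomeo v + t • w ∈ ψ.toHomeo.target →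
        orbitType G (ψ.toHomeo.symm (ψ.toHomeo v + t • w)) = orbitType G v := by
  obtain ⟨c, -, U, χ, -, -, -, hsec, hΦ, hmΦ⟩ := hS.local_product
  obtain ⟨X, ρ, O, ι, hρc, -, -, hρO, hι, hιO, -, hequiv⟩ := hS.linear
  let _ := hS.submanifold.charted
  obtain ⟨e, hes, hef, -, hesm, hesm'⟩ := hΦ.exists_openPartialHomeomorph
  obtain ⟨j, hjs, hjf, hjt, hjsm, hjsm'⟩ := hι.exists_openPartialHomeomorph
  let c₀ : LCChart.{uE} (G ⧸ MulAction.stabilizer G m) := c.chartAt ((1 : G) : G ⧸ _)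
  -- The second coordinate is the linear one given by `ι`, not a chart of the atlas of `S`;
  -- compatibility follows from smoothness of `ι` and its inverse.
  let κ : LCChart.{uE} ((G ⧸ MulAction.stabilizer G m) × S) :=
    ⟨LCSpace.prod c₀.model X, c₀.toHomeo.prod j.symm⟩
  let ψ : LCChart.{uE} M := ⟨κ.model, e.symm.trans κ.toHomeo⟩
  have hψ : ψ ∈ maxAtlas.{uE} M := by
    refine mem_maxAtlas_of_diffeo hesm hesm' ?_
    rintro ⟨u, s⟩ ⟨hu, hs⟩
    have hu : u ∈ c₀.toHomeo.source := hu
    have hs : s ∈ j.target := hs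
    have hsσ := LCChartedSpace.mem_chart_source.{uE} s
    have hid : ∀ (Y : LCSpace.{uE}) (y : Y),
        IsSmoothAt (fun z : c₀.model × Y => c₀.toHomeo (c₀.toHomeo.symm z.1)) (c₀.toHomeo u, y) := by
      intro Y y
      refine ((ContinuousLinearMap.fst ℝ c₀.model Y).isSmoothAt _).congr ?_
      filter_upwards [continuous_fst.continuousAt.preimage_mem_nhds
        (c₀.toHomeo.open_target.mem_nhds (c₀.toHomeo.map_source hu))] with z hz
      exact (c₀.toHomeo.right_inv hz).symm
    refine ⟨⟨LCSpace.prod c₀.model (LCChartedSpace.chartAt.{uE} s).model,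
      c₀.toHomeo.prod (LCChartedSpace.chartAt.{uE} s).toHomeo⟩,
      ⟨c₀, c.chart_mem_atlas _, _, LCChartedSpace.chart_mem_atlas s, rfl⟩, ⟨hu, hsσ⟩, ?_, ?_⟩
    · have h1 := hjsm.isSmoothAt j.open_source (c := ⟨X, OpenPartialHomeomorph.refl X⟩) rfl
        (LCChartedSpace.chart_mem_atlas.{uE} s) (j.map_target hs) trivial
        (by rw [j.right_inv hs]; exact hsσ)
      exact (hid _ (j.symm s)).prodMk (IsSmoothAt.comp (f := fun z : c₀.model × X => z.2)
        (x := (c₀.toHomeo u, j.symm s)) h1 ((ContinuousLinearMap.snd ℝ c₀.model X).isSmoothAt _))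
    · have h1 := hjsm'.isSmoothAt j.open_target (LCChartedSpace.chart_mem_atlas.{uE} s)
        (d := ⟨X, OpenPartialHomeomorph.refl X⟩) rfl hs hsσ trivial
      exact (hid _ _).prodMk (IsSmoothAt.comp
        (f := fun z : c₀.model × (LCChartedSpace.chartAt.{uE} s).model => z.2)
        (x := (c₀.toHomeo u, (LCChartedSpace.chartAt.{uE} s).toHomeo s)) h1
        ((ContinuousLinearMap.snd ℝ c₀.model (LCChartedSpace.chartAt.{uE} s).model).isSmoothAt _))
  -- The stabilizer of `ι x` in `G` lies in `G_m`, so by equivariance and injectivity of `ι` on `O`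
  -- it is the isotropy group of `x` under `ρ`.
  have hstab : ∀ x ∈ O, ∀ g : G, g ∈ MulAction.stabilizer G (ι x : M) ↔
      ∃ hg : g ∈ MulAction.stabilizer G m, ρ ⟨g, hg⟩ x = x := by
    intro x hx g
    have hinj : InjOn ι O := by rw [← hjf, ← hjs]; exact j.injOn
    constructor
    · intro hg
      have hgm := hS.toIsSlice.stabilizer_le (ι x).2 hg
      refine ⟨hgm, hinj (hρO _ x hx) hx (Subtype.ext ?_)⟩
      rw [hequiv _ x hx]
      exact hg
    · rintro ⟨hg, h⟩
      have := hequiv ⟨g, hg⟩ x hx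
      rw [h] at this
      exact this.symm
  have hsymm : ∀ y : c₀.model × X, ψ.toHomeo.symm y = χ (c₀.toHomeo.symm y.1) • (ι y.2 : M) := by
    intro y
    have : ψ.toHomeo.symm y = e (c₀.toHomeo.symm y.1, j y.2) := rfl
    rw [this, hef, hjf]
  have htype : ∀ y : c₀.model × X, orbitType G (ψ.toHomeo.symm y) = orbitType G (ι y.2 : M) :=
    fun y => by rw [hsymm, orbitType_smul]
  have htO : ∀ y : c₀.model × X, y ∈ ψ.toHomeo.target → y.2 ∈ O := by
    intro y hy
    have : y.2 ∈ j.source := hy.1.2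
    rwa [hjs] at this
  -- The direction from conjugate to fixed is where compactness of `G_m` is needed.
  have hinv : ∀ x ∈ O, x ∈ ρ.invariants ↔ orbitType G (ι x : M) = orbitType G m := by
    intro x hx
    rw [Representation.mem_invariants]
    constructor
    · refine fun h => congrArg orbitTypeClass
        (le_antisymm (hS.toIsSlice.stabilizer_le (ι x).2) fun g hg => ?_)
      exact (hstab x hx g).2 ⟨hg, h _⟩
    · rintro h ⟨g, hg⟩
      have := hS.toIsSlice.stabilizer_eq_of_conj_le hG hproper h
        (hS.toIsSlice.stabilizer_le (ι x).2)
      exact ((hstab x hx g).1 (this ▸ hg)).2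
  have hleft : ∀ v ∈ ψ.toHomeo.source, ψ.toHomeo.symm (ψ.toHomeo v) = v := fun v hv =>
    ψ.toHomeo.left_inv hv
  have htypev : ∀ v ∈ ψ.toHomeo.source, orbitType G v = orbitType G (ι (ψ.toHomeo v).2 : M) :=
    fun v hv => by rw [← htype, hleft v hv]
  -- The chart `c₀` is only known to contain the base coset. If `χ u • s = m`, the slice axiom puts
  -- `χ u` in the stabilizer, so `u` is that coset.
  have hmem : m ∈ ψ.toHomeo.source := by
    obtain ⟨⟨u, s⟩, ⟨hu, -⟩, hus⟩ := hmΦ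
    have hus : χ u • (s : M) = m := hus
    have hχu : χ u ∈ MulAction.stabilizer G m := hS.mem_stabilizer _ ⟨s, s.2, hus.symm ▸ hS.mem⟩
    have hu1 : u = ((1 : G) : G ⧸ MulAction.stabilizer G m) := by
      rw [← hsec u hu]
      exact (QuotientGroup.eq.2 (by simpa using hχu)).symm
    have hes' : ((u, s) : (G ⧸ MulAction.stabilizer G m) × S) ∈ e.source := by
      rw [hes]; exact ⟨hu, trivial⟩
    have heus : e (u, s) = m := by rw [hef]; exact hus
    refine ⟨?_, ?_⟩
    · have := e.map_source hes'
      rwa [heus] at this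
    · have h1 := e.left_inv hes'
      rw [heus] at h1
      change e.symm m ∈ κ.toHomeo.source
      rw [h1]
      refine ⟨?_, ?_⟩
      · change u ∈ c₀.toHomeo.source
        rw [hu1]; exact c.mem_chart_source _
      change s ∈ j.target
      rw [hjt, hιO]; trivial
  refine ⟨ψ, hψ, hmem, (⊤ : Submodule ℝ c₀.model).prod ρ.invariants, ⟨?_, ?_⟩, ?_, ?_⟩
  · have hcont : ∀ g, Continuous fun p : c₀.model × X => ρ g p.2 := fun g =>
      hρc.comp (continuous_const.prodMk continuous_snd)
    have : (((⊤ : Submodule ℝ c₀.model).prod ρ.invariants : Submodule ℝ (c₀.model × X)) :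
        Set (c₀.model × X)) = ⋂ g, {p : c₀.model × X | ρ g p.2 = p.2} := by
      ext p
      simp [Representation.mem_invariants]
    exact this ▸ isClosed_iInter fun g => isClosed_eq (hcont g) continuous_snd
  · have hiff : ∀ v ∈ ψ.toHomeo.source, orbitType G v = orbitType G m ↔
        ψ.toHomeo v ∈ (⊤ : Submodule ℝ c₀.model).prod ρ.invariants := by
      intro v hv
      rw [htypev v hv, ← hinv _ (htO _ (ψ.toHomeo.map_source hv))]
      exact ⟨fun h => ⟨trivial, h⟩, fun h => h.2⟩
    ext y
    constructor
    · rintro ⟨v, ⟨hv, hvt⟩, rfl⟩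
      exact ⟨ψ.toHomeo.map_source hv, (hiff v hv).1 hvt⟩
    · rintro ⟨hy, hyF⟩
      have hy' := ψ.toHomeo.map_target hy
      refine ⟨_, ⟨hy', (hiff _ hy').2 ?_⟩, ψ.toHomeo.right_inv hy⟩
      rwa [ψ.toHomeo.right_inv hy]
  · intro v hv
    exact ⟨_, _, (htypev v hv).symm, rfl, hS.toIsSlice.stabilizer_le (ι (ψ.toHomeo v).2).2⟩
  · rintro v hv w hw t ht
    rw [htypev v hv, htype]
    refine congrArg orbitTypeClass ?_
    ext g
    rw [hstab _ (htO _ ht), hstab _ (htO _ (ψ.toHomeo.map_source hv))]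
    refine exists_congr fun hg => ?_
    have hw2 : ρ ⟨g, hg⟩ w.2 = w.2 := (Representation.mem_invariants ρ _).1 hw.2 _
    have : (ψ.toHomeo v + t • w).2 = (ψ.toHomeo v).2 + t • w.2 := rfl
    -- Adding a fixed vector to `x` changes both sides of `ρ g x = x` by the same amount.
    rw [this, map_add, map_smul, hw2, add_left_inj]

end Slice

/-! ### Tangent maps between strata and the order of orbit types. -/

section Strata

/-- The map is the derivative at `x` of the change of charts. Lines in direction `A` move `x` only
along `B`, and `B` is closed, so the derivative sends `A` into `B`. -/
theorem exists_injective_of_charts {M : Type*} [TopologicalSpace M] [LCChartedSpace.{uE} M]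
    {φ ψ : LCChart.{uE} M} (hφ : φ ∈ maxAtlas.{uE} M) (hψ : ψ ∈ maxAtlas.{uE} M) {x : M}
    (hx : x ∈ φ.toHomeo.source) (hx' : x ∈ ψ.toHomeo.source) {A : Submodule ℝ φ.model}
    {B : Submodule ℝ ψ.model} (hB : IsClosed (B : Set ψ.model))
    (hAB : ∀ w ∈ A, ∀ t : ℝ, φ.toHomeo x + t • w ∈ φ.toHomeo.target →
      φ.toHomeo.symm (φ.toHomeo x + t • w) ∈ ψ.toHomeo.source →
      ψ.toHomeo (φ.toHomeo.symm (φ.toHomeo x + t • w)) - ψ.toHomeo x ∈ B) :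
    ∃ L : A →L[ℝ] B, Function.Injective L := by
  have e : φ.toHomeo.symm (φ.toHomeo x) = x := φ.toHomeo.left_inv hx
  have hnear : ∀ᶠ y in 𝓝 (φ.toHomeo x),
      y ∈ φ.toHomeo.target ∧ φ.toHomeo.symm y ∈ ψ.toHomeo.source :=
    Eventually.and (φ.toHomeo.open_target.mem_nhds (φ.toHomeo.map_source hx))
      ((φ.toHomeo.continuousAt_symm (φ.toHomeo.map_source hx)).preimage_mem_nhds
        (ψ.toHomeo.open_source.mem_nhds (by rwa [e])))
  obtain ⟨L, hL, -⟩ := ((smoothTransition_of_mem_maxAtlas hφ hψ).isSmoothAt hx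
    hx').exists_injective_restrict (g := φ.toHomeo ∘ ψ.toHomeo.symm) (A := A) (B := B) (by
      simpa only [Function.comp, e] using
        (smoothTransition_of_mem_maxAtlas hψ hφ).isSmoothAt hx' hx) (by
      filter_upwards [hnear] with y hy
      simp only [Function.comp, ψ.toHomeo.left_inv hy.2, φ.toHomeo.right_inv hy.1]) hB (by
      intro w hw
      filter_upwards [(tendsto_add_smul (φ.toHomeo x) w).eventually hnear] with t ht
      simpa only [Function.comp, e] using hAB w hw t ht.1 ht.2)
  exact ⟨L, hL⟩

/-- The tangent space is the model of a chosen restricted chart; this exposes the adapted chart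
behind the choice. -/
theorem IsSubmanifold.exists_tangentLC_eq {M : Type*} [TopologicalSpace M] [LCChartedSpace.{uE} M]
    {S : Set M} (hS : IsSubmanifold.{uE} S) (x : S) :
    ∃ φ ∈ maxAtlas.{uE} M, (x : M) ∈ φ.toHomeo.source ∧ ∃ F : Submodule ℝ φ.model,
      φ.IsAdapted F S ∧ TangentLC hS.charted x = φ.model.sub F :=
  ⟨_, (hS x x.2).choose_spec.1, (hS x x.2).choose_spec.2.1, _,
    (hS x x.2).choose_spec.2.2.choose_spec, rfl⟩

variable {G M : Type*} [Group G] [TopologicalSpace G] [LCChartedSpace.{uE} G]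
  [TopologicalSpace M] [LCChartedSpace.{uE} M] [MulAction G M]

theorem orbitTypeClass_map_conj (a : G) (K : Subgroup G) :
    orbitTypeClass (K.map (MulAut.conj a).toMonoidHom) = orbitTypeClass K :=
  (orbitTypeClass_eq_iff.2 ⟨a, rfl⟩).symm

/-- After conjugation, a representative of `κ` lies between a conjugate of the stabilizer and the
stabilizer itself. By compactness these two coincide, which squeezes the representative. -/
theorem IsSlice.orbitType_antisymm (hG : IsLCLieGroup.{uE} G) (hproper : IsProperAction G M)
    {S : Set M} {m : M} (hS : IsSlice.{uE} G S m) {κ : OrbitTypeClass G} (h : orbitType G m ≤ κ)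
    (h' : κ ≤ orbitType G m) : orbitType G m = κ := by
  obtain ⟨K, K', hK, rfl, hKK'⟩ := h
  obtain ⟨L', L, hL', hL, hLL'⟩ := h'
  obtain ⟨a, ha⟩ := orbitTypeClass_eq_iff.1 hL
  obtain ⟨b, hb⟩ := orbitTypeClass_eq_iff.1 (hL'.symm.trans (orbitTypeClass_map_conj a L').symm)
  have h1 : K'.map (MulAut.conj b).toMonoidHom ≤ MulAction.stabilizer G m := by
    rw [hb, ← ha]
    exact Subgroup.map_mono hLL'
  have h2 := Subgroup.map_mono (f := (MulAut.conj b).toMonoidHom) hKK'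
  have h3 := hS.stabilizer_eq_of_conj_le hG hproper ((orbitTypeClass_map_conj b K).trans hK)
    (h2.trans h1)
  rw [← orbitTypeClass_map_conj b K', le_antisymm h1 (h3 ▸ h2)]
  rfl

/-- The map goes through the subspace `F` of the slice chart. At `m`, both `F` and the chosen
tangent space describe the stratum of `m`; at `v`, translation along `F` stays inside the stratum of
`v`. -/
theorem IsLinearSlice.exists_injective_tangent (hG : IsLCLieGroup.{uE} G)
    (hproper : IsProperAction G M) {κ η : OrbitTypeClass G}
    (hκ : IsSubmanifold.{uE} (orbitTypeSet M κ)) (hη : IsSubmanifold.{uE} (orbitTypeSet M η))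
    (m : orbitTypeSet M η) {S : Set M} (hS : IsLinearSlice.{uE} G S (m : M)) :
    ∃ V : Set M, IsOpen V ∧ (m : M) ∈ V ∧ ∀ v : orbitTypeSet M κ, (v : M) ∈ V →
      ∃ f : TangentLC hη.charted m →L[ℝ] TangentLC hκ.charted v, Function.Injective f := by
  obtain ⟨ψ, hψ, hm, F, hF, -, htrans⟩ := hS.exists_chart hG hproper
  rw [show orbitType G (m : M) = η from m.2] at hF
  refine ⟨ψ.toHomeo.source, ψ.toHomeo.open_source, hm, fun v hv => ?_⟩
  obtain ⟨φ, hφ, hmφ, A, hA, eA⟩ := hη.exists_tangentLC_eq m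
  obtain ⟨φ', hφ', hvφ', B, hB, eB⟩ := hκ.exists_tangentLC_eq v
  rw [eA, eB]
  obtain ⟨L, hL⟩ := exists_injective_of_charts hφ hψ hmφ hm (A := A) hF.1
    fun w hw t ht ht' => F.sub_mem (hF.apply_mem ⟨_, hA.symm_mem
      ⟨_, A.add_mem (hA.apply_mem m hmφ) (A.smul_mem t hw)⟩ ht⟩ ht') (hF.apply_mem m hm)
  obtain ⟨L', hL'⟩ := exists_injective_of_charts hψ hφ' hv hvφ' (A := F) hB.1
    fun w hw t ht ht' => B.sub_mem
      (hB.apply_mem ⟨_, (htrans v hv w hw t ht).trans v.2⟩ ht') (hB.apply_mem v hvφ')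
  exact ⟨L'.comp L, hL'.comp hL⟩

/-- Orbit types near `m` are at most the orbit type of `m`. -/
theorem IsLinearSlice.le_of_mem_closure (hG : IsLCLieGroup.{uE} G) (hproper : IsProperAction G M)
    {S : Set M} {m : M} (hS : IsLinearSlice.{uE} G S m) {κ : OrbitTypeClass G}
    (h : m ∈ closure (orbitTypeSet M κ)) : κ ≤ orbitType G m := by
  obtain ⟨ψ, -, hm, -, -, hle, -⟩ := hS.exists_chart hG hproper
  obtain ⟨v, hv, rfl⟩ := mem_closure_iff.1 h _ ψ.toHomeo.open_source hm
  exact hle v hv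

end Strata

theorem mainTheorem8 {G : Type uG} {M : Type uM} [Group G] [TopologicalSpace G]
    [LCChartedSpace.{uE} G] [TopologicalSpace M] [LCChartedSpace.{uE} M] [MulAction G M]
    (hG : IsLCLieGroup.{uE} G) (hM : IsGManifold.{uE} G M) (hproper : IsProperAction G M)
    (hslice : ∀ m : M, ∃ (S : Set M) (hS : IsLinearSlice.{uE} G S m),
      hS.toIsSlice.AdmitsLinearSlices)
    (happrox : ∀ κ : OrbitTypes G M, orbitTypeSetGE M κ.1 ⊆ closure (orbitTypeSet M κ.1)) :
    ∃ hsub : ∀ κ : OrbitTypes G M, IsSubmanifold.{uE} (orbitTypeSet M κ.1),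
      (∀ κ η : OrbitTypes G M, κ.1 ≤ η.1 → ∀ m : orbitTypeSet M η.1,
        ∃ V : Set M, IsOpen V ∧ (m : M) ∈ V ∧ ∀ v : orbitTypeSet M κ.1, (v : M) ∈ V →
          ∃ f : TangentLC (hsub η).charted m →L[ℝ] TangentLC (hsub κ).charted v,
            Function.Injective f) ∧
      IsStratification (fun κ : OrbitTypes G M => orbitTypeSet M κ.1)
        (fun κ => (hsub κ).charted) ∧
      IsSmoothlyRegular (fun κ : OrbitTypes G M => orbitTypeSet M κ.1)
        (fun κ => (hsub κ).charted) := by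
  have hslice' : ∀ m : M, ∃ S : Set M, IsLinearSlice.{uE} G S m := fun m =>
    let ⟨S, hS, _⟩ := hslice m; ⟨S, hS⟩
  have hsub : ∀ κ : OrbitTypes G M, IsSubmanifold.{uE} (orbitTypeSet M κ.1) := by
    intro κ x hx
    obtain ⟨S, hS⟩ := hslice' x
    obtain ⟨ψ, hψ, hxψ, F, hF, -⟩ := hS.exists_chart hG hproper
    rw [show orbitType G x = κ.1 from hx] at hF
    exact ⟨ψ, hψ, hxψ, F, hF⟩
  have hdisj : ∀ i j : OrbitTypes G M, i ≠ j →
      Disjoint (orbitTypeSet M i.1) (orbitTypeSet M j.1) := fun i j hij =>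
    disjoint_left.2 fun x (hx : _ = _) (hx' : _ = _) => hij (Subtype.ext (hx.symm.trans hx'))
  have hle : ∀ i j : OrbitTypes G M,
      (orbitTypeSet M i.1 ∩ closure (orbitTypeSet M j.1)).Nonempty → j.1 ≤ i.1 := by
    rintro i j ⟨x, hx, hxj⟩
    obtain ⟨S, hS⟩ := hslice' x
    have := hS.le_of_mem_closure hG hproper hxj
    rwa [show orbitType G x = i.1 from hx] at this
  have hreg : ∀ κ η : OrbitTypes G M, ∀ m : orbitTypeSet M η.1,
      ∃ V : Set M, IsOpen V ∧ (m : M) ∈ V ∧ ∀ v : orbitTypeSet M κ.1, (v : M) ∈ V →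
        ∃ f : TangentLC (hsub η).charted m →L[ℝ] TangentLC (hsub κ).charted v,
          Function.Injective f := by
    intro κ η m
    obtain ⟨S, hS⟩ := hslice' m
    exact hS.exists_injective_tangent hG hproper (hsub κ) (hsub η) m
  refine ⟨hsub, fun κ η _ m => hreg κ η m, ?_, fun i j _ x => hreg j i x⟩
  exact
    { t2 := hM.manifold.t2
      nonempty := fun κ => κ.2
      disjoint := hdisj
      cover := eq_univ_of_forall fun x => mem_iUnion.2 ⟨⟨orbitType G x, x, rfl⟩, rfl⟩
      locallyClosed := fun κ => (hsub κ).isLocallyClosed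
      manifold := fun κ => (hsub κ).isLCManifold_charted hM.manifold
      -- A single adherent point gives `j ≤ i` as orbit types; the approximation property then puts
      -- every point of stratum `i` in the closure of stratum `j`.
      frontier_subset := fun i j hij x (hx : _ = _) =>
        ⟨happrox j (show j.1 ≤ orbitType G x from hx.symm ▸ hle i j hij.2),
          disjoint_left.1 (hdisj i j hij.1) hx⟩
      -- If each stratum met the closure of the other, the two orbit types would be comparable both
      -- ways, hence equal.
      frontier_disjoint := by
        intro i j hij
        by_contra hne
        have hji := hle i j hij.2
        have hij' := hle j i (not_disjoint_iff_nonempty_inter.1 hne)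
        obtain ⟨x, hx⟩ := i.2
        obtain ⟨S, hS⟩ := hslice' x
        exact hij.1 (Subtype.ext (hx.symm.trans
          (hS.toIsSlice.orbitType_antisymm hG hproper (hx ▸ hij') (hx ▸ hji)))) }
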